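/- Let $K$ be an algebraically closed field and $A$ a finite-dimensional basic $K$-algebra with a complete system of pairwise orthogonal primitive idempotents $(e_i)_{i\in Q_0}$ (for instance a bound quiver algebra $KQ/\mathcal I$ with its trivial paths), where $Q_0$ is finite and carries a partial order $\leqslant$. Modules are finite-dimensional left modules; $P(i)=Ae_i$, $I(i)=\mathrm{Hom}_K(e_iA,K)$, $S(i)=\mathrm{top}\,P(i)$, and $[M:S(i)]=\dim_K e_iM$. The standard module $\Delta(i)$ is the largest factor module of $P(i)$, and the costandard module $\nabla(i)$ the largest submodule of $I(i)$, having no composition factor $S(j)$ with $j\not\leqslant i$. A $\Delta$-good (resp. $\nabla$-good) filtration of $M$ is a finite chain of submodules from $0$ to $M$ each of whose successive subquotients is isomorphic to some $\Delta(i)$ (resp. $\nabla(i)$); $(M:\Delta(i))$ is the number of subquotients isomorphic to $\Delta(i)$ in such a filtration. Suppose that $(A,\leqslant)$ is 1-quasi-hereditary, that is: it is quasi-hereditary (for all $i,j$: $[\Delta(i):S(i)]=1$, and $P(i)$ has a $\Delta$-good filtration, with $(P(i):\Delta(i))=1$ and $(P(i):\Delta(j))=0$ for $j\not\geqslant i$)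 and, moreover, (1) $Q_0$ has a smallest element $1$ and a largest element $n$; (2) $[\Delta(i):S(j)]=(P(j):\Delta(i))=1$ for $j\leqslant i$; (3) $\mathrm{soc}\,P(j)\cong\mathrm{top}\,I(j)\cong S(1)$ for all $j$; (4) for all $i$ there are a monomorphism $\Delta(i)\hookrightarrow\Delta(n)$ and an epimorphism $\nabla(n)\twoheadrightarrow\nabla(i)$. Let $j\in Q_0$, $\Lambda^{(j)}=\{i\in Q_0\mid i\geqslant j\}$, $r=|\Lambda^{(j)}|$, and $$\mathcal L(j)=\{(i_1,\dots,i_r)\mid i_m\in\Lambda^{(j)},\ i_k\not\geqslant i_t\text{ for }1\le k<t\le r\}.$$ (1) For each $i\in\Lambda^{(j)}$ the module $P(j)$ has exactly one submodule isomorphic to $P(i)$, which is again denoted by $P(i)$. The map $\mathscr D$ that sends $\mathbf i=(i_1,\dots,i_r)\in\mathcal L(j)$ to $$0=D(r+1)\subset D(r)\subset\dots\subset D(1)=P(j),\qquad D(t)=\sum_{m=t}^{r}P(i_m),$$ is a bijection from $\mathcal L(j)$ onto the set of $\Delta$-good filtrations of $P(j)$, and $D(t)/D(t+1)\cong\Delta(i_t)$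 for $1\le t\le r$. (2) For each $i\in Q_0$ there is exactly one submodule $\mathcal K(i)$ of $P(1)$ with $P(1)/\mathcal K(i)\cong I(i)$, and $\mathcal K(j)\subseteq\mathcal K(i)$ for $i\in\Lambda^{(j)}$. Identify $I(j)$ with $P(1)/\mathcal K(j)$ by means of any epimorphism $P(1)\twoheadrightarrow I(j)$. The map $\mathscr N$ that sends $\mathbf i\in\mathcal L(j)$ to $$0=N(1)\subset\dots\subset N(r)\subset N(r+1)=I(j),\qquad N(t)=\Big(\bigcap_{m=t}^{r}\mathcal K(i_m)\Big)/\mathcal K(j)\quad(1\le t\le r),$$ does not depend on the chosen epimorphism and is a bijection from $\mathcal L(j)$ onto the set of $\nabla$-good filtrations of $I(j)$, and $N(t+1)/N(t)\cong\nabla(i_t)$ for $1\le t\le r$. -/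

import Mathlib

namespace OneQH

/-! ### Basic algebras, projective, injective and simple modules

Modules are left modules. A basic algebra is given by a complete system of pairwise orthogonal
primitive idempotents `e i`, indexed by the vertices, with pairwise non-isomorphic modules
`A e i`. For a bound quiver algebra these are the trivial paths. -/

/-- An idempotent `e ≠ 0` which is not a sum of two non-zero orthogonal idempotents. -/
def IsPrimitive {A : Type*} [Ring A] (e : A) : Prop :=
  IsIdempotentElem e ∧ e ≠ 0 ∧
    ∀ f g : A, IsIdempotentElem f → IsIdempotentElem g → f * g = 0 → g * f = 0 →
      e = f + g → f = 0 ∨ g = 0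

/-- The projective module `P(i) = A e i`. -/
abbrev Proj {A ι : Type*} [Ring A] (e : ι → A) (i : ι) : Submodule A A :=
  Submodule.span A {e i}

/-- `e` is a complete system of primitive orthogonal idempotents exhibiting `A` as basic. -/
structure IsBasicSystem {A ι : Type*} [Ring A] [Fintype ι] (e : ι → A) : Prop where
  complete : CompleteOrthogonalIdempotents e
  primitive : ∀ i, IsPrimitive (e i)
  basic : ∀ i j, Nonempty (Proj e i ≃ₗ[A] Proj e j) → i = j

/-- The right ideal `e A`, as a `K`-subspace of `A`. -/
def rightIdeal (K : Type*) {A : Type*} [Field K] [Ring A] [Algebra K A] (e : A) :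
    Submodule K A :=
  LinearMap.range (LinearMap.mulLeft K e)

theorem mul_mem_rightIdeal {K A : Type*} [Field K] [Ring A] [Algebra K A] (e : A)
    {x : A} (hx : x ∈ rightIdeal K e) (a : A) : x * a ∈ rightIdeal K e := by
  obtain ⟨y, rfl⟩ := hx
  exact ⟨y * a, by simp [mul_assoc]⟩

/-- Right multiplication by `a` on the right ideal `e A`. -/
def rightMul (K : Type*) {A : Type*} [Field K] [Ring A] [Algebra K A] (e a : A) :
    rightIdeal K e →ₗ[K] rightIdeal K e :=
  (LinearMap.mulRight K a).restrict fun _ hx => mul_mem_rightIdeal e hx a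

/-- The injective module `I(i) = Hom_K (e i A, K)`. -/
def Inj (K : Type*) {A ι : Type*} [Field K] [Ring A] [Algebra K A] (e : ι → A) (i : ι) :
    Type _ :=
  Module.Dual K (rightIdeal K (e i))

section InjInstances

variable {K A ι : Type*} [Field K] [Ring A] [Algebra K A] (e : ι → A) (i : ι)

instance : AddCommGroup (Inj K e i) :=
  inferInstanceAs (AddCommGroup (Module.Dual K (rightIdeal K (e i))))

instance : Module K (Inj K e i) :=
  inferInstanceAs (Module K (Module.Dual K (rightIdeal K (e i))))

/-- The left action `(a • φ) x = φ (x * a)`. -/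
instance : Module A (Inj K e i) where
  smul a φ := LinearMap.comp (φ : Module.Dual K (rightIdeal K (e i))) (rightMul K (e i) a)
  one_smul φ := by
    apply LinearMap.ext
    intro x
    exact congrArg φ.toFun (Subtype.ext (mul_one x.1))
  mul_smul a b φ := by
    apply LinearMap.ext
    intro x
    exact congrArg φ.toFun (Subtype.ext (mul_assoc x.1 a b).symm)
  smul_zero a := LinearMap.zero_comp _
  smul_add a φ ψ := LinearMap.add_comp _ _ _
  add_smul a b φ := by
    apply LinearMap.ext
    intro x
    refine (congrArg φ.toFun (show rightMul K (e i) (a + b) x = rightMul K (e i) a x + rightMul K (e i) b x from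
      Subtype.ext (mul_add x.1 a b))).trans ?_
    exact φ.map_add' (rightMul K (e i) a x) (rightMul K (e i) b x)
  zero_smul φ := by
    apply LinearMap.ext
    intro x
    refine (congrArg φ.toFun (show rightMul K (e i) 0 x = 0 from Subtype.ext (mul_zero x.1))).trans ?_
    exact LinearMap.map_zero (φ : Module.Dual K (rightIdeal K (e i)))

theorem Inj.smul_apply (a : A) (φ : Inj K e i) (x : rightIdeal K (e i)) :
    (show Module.Dual K (rightIdeal K (e i)) from a • φ) x =
      (show Module.Dual K (rightIdeal K (e i)) from φ)
        ⟨x.1 * a, mul_mem_rightIdeal (e i) x.2 a⟩ :=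
  rfl

instance : IsScalarTower K A (Inj K e i) where
  smul_assoc c a φ := by
    apply LinearMap.ext
    intro x
    refine (congrArg φ.toFun (show rightMul K (e i) (c • a) x = c • rightMul K (e i) a x from
      Subtype.ext (mul_smul_comm c x.1 a))).trans ?_
    exact φ.map_smul' c (rightMul K (e i) a x)

end InjInstances

/-- The top `M / rad M`. -/
abbrev Top (A M : Type*) [Ring A] [AddCommGroup M] [Module A M] : Type _ :=
  M ⧸ Module.jacobson A M

/-- The socle: the sum of all simple submodules. -/
def socle (A M : Type*) [Ring A] [AddCommGroup M] [Module A M] : Submodule A M :=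
  sSup {N | IsSimpleModule A N}

/-- The simple module `S(i)`, the top of `P(i)`. -/
abbrev Simp {A ι : Type*} [Ring A] (e : ι → A) (i : ι) : Type _ :=
  Top A (Proj e i)

/-- The `K`-subspace `M_i = e i • M` of `M`. -/
def vertexSpace (K : Type*) {A ι : Type*} [Field K] [Ring A] [Algebra K A] (e : ι → A)
    (M : Type*) [AddCommGroup M] [Module K M] [Module A M] [IsScalarTower K A M] (i : ι) :
    Submodule K M :=
  LinearMap.range (Algebra.lsmul K K M (e i))

/-- The Jordan-Hölder multiplicity `[M : S(i)] = dim_K M_i`. -/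
noncomputable def mult (K : Type*) {A ι : Type*} [Field K] [Ring A] [Algebra K A] (e : ι → A)
    (M : Type*) [AddCommGroup M] [Module K M] [Module A M] [IsScalarTower K A M] (i : ι) : ℕ :=
  Module.finrank K (vertexSpace K e M i)

theorem mult_eq_zero_iff {K A ι : Type*} [Field K] [Ring A] [Algebra K A] (e : ι → A)
    {M : Type*} [AddCommGroup M] [Module K M] [Module A M]
    [IsScalarTower K A M] [FiniteDimensional K M] (j : ι) :
    mult K e M j = 0 ↔ ∀ x : M, e j • x = 0 := by
  unfold mult vertexSpace
  rw [Submodule.finrank_eq_zero, LinearMap.range_eq_bot, LinearMap.ext_iff]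
  rfl

/-! ### Standard and costandard modules -/

section Standard

variable (K : Type*) {A ι : Type*} [Field K] [Ring A] [Algebra K A] [PartialOrder ι] (e : ι → A)

/-- The smallest submodule `U` of `P(i)` such that `[P(i)/U : S(j)] = 0` for all `j ≰ i`. -/
def stdKer (i : ι) : Submodule A (Proj e i) :=
  sInf {U | ∀ j, ¬ j ≤ i → mult K e (Proj e i ⧸ U) j = 0}

/-- The standard module `Δ(i)`, the largest factor module of `P(i)` with `[Δ(i) : S(j)] = 0`
for all `j ≰ i`. -/
abbrev Std (i : ι) : Type _ := Proj e i ⧸ stdKer K e i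

/-- The costandard module `∇(i)`, the largest submodule of `I(i)` with `[∇(i) : S(j)] = 0`
for all `j ≰ i`. -/
def Costd (i : ι) : Submodule A (Inj K e i) :=
  sSup {N | ∀ j, ¬ j ≤ i → mult K e N j = 0}

theorem stdKer_isLeast [FiniteDimensional K A] (i : ι) :
    IsLeast {U : Submodule A (Proj e i) | ∀ j, ¬ j ≤ i → mult K e (Proj e i ⧸ U) j = 0}
      (stdKer K e i) := by
  have key : ∀ (U : Submodule A (Proj e i)) (j : ι),
      mult K e (Proj e i ⧸ U) j = 0 ↔ ∀ x : Proj e i, e j • x ∈ U := by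
    intro U j
    have : FiniteDimensional K (Proj e i) :=
      inferInstanceAs (FiniteDimensional K ((Proj e i).restrictScalars K))
    have : FiniteDimensional K (Proj e i ⧸ U) :=
      Module.Finite.of_surjective (U.mkQ.restrictScalars K) U.mkQ_surjective
    rw [mult_eq_zero_iff]
    constructor
    · intro h x
      exact (Submodule.Quotient.mk_eq_zero U).1 (h (Submodule.Quotient.mk x))
    · intro h y
      obtain ⟨x, rfl⟩ := U.mkQ_surjective y
      exact (Submodule.Quotient.mk_eq_zero U).2 (h x)
  refine ⟨fun j hj => (key _ j).2 fun x => ?_, fun U hU => sInf_le hU⟩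
  exact Submodule.mem_sInf.2 fun U hU => (key U j).1 (hU j hj) x

theorem costd_isGreatest [FiniteDimensional K A] (i : ι) :
    IsGreatest {N : Submodule A (Inj K e i) | ∀ j, ¬ j ≤ i → mult K e N j = 0}
      (Costd K e i) := by
  have key : ∀ (N : Submodule A (Inj K e i)) (j : ι),
      mult K e N j = 0 ↔ ∀ x ∈ N, e j • x = 0 := by
    intro N j
    have : FiniteDimensional K (Inj K e i) :=
      inferInstanceAs (FiniteDimensional K (Module.Dual K (rightIdeal K (e i))))
    have : FiniteDimensional K N :=
      inferInstanceAs (FiniteDimensional K (N.restrictScalars K))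
    rw [mult_eq_zero_iff]
    exact ⟨fun h x hx => congrArg Subtype.val (h ⟨x, hx⟩),
      fun h x => Subtype.ext (h x.1 x.2)⟩
  refine ⟨fun j hj => (key _ j).2 fun x hx => ?_, fun N hN => le_sSup hN⟩
  unfold Costd at hx
  rw [sSup_eq_iSup'] at hx
  refine Submodule.iSup_induction _ (motive := fun y => e j • y = 0) hx ?_ (smul_zero _) ?_
  · exact fun N y hy => (key N.1 j).1 (N.2 j hj) y hy
  · intro y z hy hz
    rw [smul_add, hy, hz, add_zero]

end Standard

/-! ### Good filtrations -/

/-- The subquotient `N / N'` for submodules `N' ≤ N`. -/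
abbrev Subquot {A M : Type*} [Ring A] [AddCommGroup M] [Module A M] (N N' : Submodule A M) :
    Type _ :=
  N ⧸ N'.submoduleOf N

/-- `F` is a filtration `0 = F 0 ⊂ F 1 ⊂ ⋯ ⊂ F r = M` each of whose subquotients is isomorphic
to some `X i`. -/
structure IsGoodFiltration {A M ι : Type*} [Ring A] [AddCommGroup M] [Module A M]
    (X : ι → Type*) [∀ i, AddCommGroup (X i)] [∀ i, Module A (X i)]
    (F : LTSeries (Submodule A M)) : Prop where
  head : F.head = ⊥
  last : F.last = ⊤
  subquot : ∀ t : Fin F.length, ∃ i, Nonempty (Subquot (F t.succ) (F t.castSucc) ≃ₗ[A] X i)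

/-- `(M : X i) = m`: there is a good filtration of `M` in which precisely `m` subquotients are
isomorphic to `X i`. -/
def FiltMult (A : Type*) {ι : Type*} [Ring A] (M : Type*) [AddCommGroup M] [Module A M]
    (X : ι → Type*) [∀ i, AddCommGroup (X i)] [∀ i, Module A (X i)] (i : ι) (m : ℕ) : Prop :=
  ∃ F : LTSeries (Submodule A M), IsGoodFiltration X F ∧
    Nat.card {t : Fin F.length //
      Nonempty (Subquot (F t.succ) (F t.castSucc) ≃ₗ[A] X i)} = m

/-- The `Δ`-good filtrations of `M`. -/
abbrev StdFiltration (K : Type*) {A ι : Type*} [Field K] [Ring A] [Algebra K A] [PartialOrder ι]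
    (e : ι → A) (M : Type*) [AddCommGroup M] [Module A M] : Type _ :=
  {F : LTSeries (Submodule A M) // IsGoodFiltration (fun i => Std K e i) F}

/-- The `∇`-good filtrations of `M`. -/
abbrev CostdFiltration (K : Type*) {A ι : Type*} [Field K] [Ring A] [Algebra K A] [PartialOrder ι]
    (e : ι → A) (M : Type*) [AddCommGroup M] [Module A M] : Type _ :=
  {F : LTSeries (Submodule A M) // IsGoodFiltration (fun i => Costd K e i) F}

/-! ### Quasi-hereditary and 1-quasi-hereditary algebras -/

/-- `(A, ≤)` is quasi-hereditary. -/
structure IsQuasiHereditary (K : Type*) {A ι : Type*} [Field K] [Ring A] [Algebra K A]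
    [PartialOrder ι] (e : ι → A) : Prop where
  std_self : ∀ i, mult K e (Std K e i) i = 1
  proj_std_eq_zero : ∀ i j, ¬ i ≤ j → FiltMult A (Proj e i) (fun l => Std K e l) j 0
  proj_std_self : ∀ i, FiltMult A (Proj e i) (fun l => Std K e l) i 1

/-- `(A, ≤)` is 1-quasi-hereditary. The smallest and the largest vertex required by the
definition are `⊥` and `⊤`. -/
structure IsOneQuasiHereditary (K : Type*) {A ι : Type*} [Field K] [Ring A] [Algebra K A]
    [PartialOrder ι] [BoundedOrder ι] (e : ι → A) : Prop extends IsQuasiHereditary K e where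
  std_mult : ∀ i j, j ≤ i → mult K e (Std K e i) j = 1
  proj_mult : ∀ i j, j ≤ i → FiltMult A (Proj e j) (fun l => Std K e l) i 1
  socle_proj : ∀ j, Nonempty (socle A (Proj e j) ≃ₗ[A] Simp e ⊥)
  top_inj : ∀ j, Nonempty (Top A (Inj K e j) ≃ₗ[A] Simp e ⊥)
  std_embeds : ∀ i, ∃ f : Std K e i →ₗ[A] Std K e ⊤, Function.Injective f
  costd_covers : ∀ i, ∃ f : Costd K e ⊤ →ₗ[A] Costd K e i, Function.Surjective f

/-- The set `𝓛(j)` of sequences `(i_1, …, i_r)`, `r = |{i | j ≤ i}|`, of elements `i_m ≥ j` such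
that `i_k ≱ i_t` for all `k < t`. -/
def goodSeq {ι : Type*} [PartialOrder ι] (j : ι) : Set (Fin (Nat.card (Set.Ici j)) → ι) :=
  {s | (∀ m, j ≤ s m) ∧ ∀ k t, k < t → ¬ s t ≤ s k}

end OneQH

/-! Everything is reduced to counting dimensions of the spaces `e k • M`. Since Δ(i) has each S(k),
k ≤ i, exactly once and nothing else, the multiplicities (P(j):Δ(l)) give [P(j):S(k)] = [I(j):S(k)]
= #{l | j ≤ l, k ≤ l}; for k ≥ j this is #{l | k ≤ l} and no longer depends on j.

The socle condition embeds P(j) into I(⊥), and the top condition maps P(⊥) onto I(j); equal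
multiplicities give P(⊥) ≅ I(⊥), hence P(j) ↪ P(⊥). Independence of j then forces any embedded copy
of P(i) in P(j), i ≥ j, to be the trace of P(i) (`range_eq_trace`), and the kernel of any P(⊥) ↠
I(i) to be the largest submodule without factor S(i) (`ker_proj_bot_to_inj`). So p(i) and κ(i) are
unique, sums of the P(i) are traces of sets of vertices, and intersections of the 𝒦(i) are rejects.

For an upper set U in {l | j ≤ l} with minimal element i, passing from U to U \ {i} changes the
trace by a quotient of Δ(i) and the reject by a submodule of ∇(i). The totals for all of {l | j ≤ l}
are known, so no step can lose anything (`eq_sum_of_forall_le`) and every subquotient is the whole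
of Δ(i) or ∇(i). Conversely, a submodule of the trace of U with quotient Δ(i) must come from
removing a minimal i (`trace_lt_iff`), and dually (`lt_reject_iff`). Good filtrations are therefore
the ways to empty {l | j ≤ l} by successive removal of minimal elements, and these are the sequences
in 𝓛(j) (`eq_tail_of_chain`). -/

namespace OneQH

set_option linter.unusedSectionVars false

/-! ### Multiplicities as dimensions of the spaces `e k • M` -/

section Mult

variable {K A ι : Type*} [Field K] [Ring A] [Algebra K A] {e : ι → A}
variable {M M' : Type*} [AddCommGroup M] [Module K M] [Module A M] [IsScalarTower K A M]
  [AddCommGroup M'] [Module K M'] [Module A M'] [IsScalarTower K A M']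

theorem mem_vertexSpace (k : ι) (x : M) : x ∈ vertexSpace K e M k ↔ ∃ y : M, e k • y = x :=
  Iff.rfl

theorem mem_vertexSpace_iff {k : ι} (hk : IsIdempotentElem (e k)) (x : M) :
    x ∈ vertexSpace K e M k ↔ e k • x = x := by
  rw [mem_vertexSpace]
  constructor
  · rintro ⟨y, rfl⟩
    rw [← mul_smul, hk.eq]
  · exact fun h => ⟨x, h⟩

theorem mult_eq_of_equiv (f : M ≃ₗ[A] M') (k : ι) : mult K e M k = mult K e M' k := by
  have h : (vertexSpace K e M k).map (f.restrictScalars K).toLinearMap = vertexSpace K e M' k := by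
    ext x
    simp only [Submodule.mem_map, mem_vertexSpace]
    constructor
    · rintro ⟨_, ⟨y, rfl⟩, rfl⟩
      exact ⟨f y, (map_smul f _ _).symm⟩
    · rintro ⟨y, rfl⟩
      exact ⟨e k • f.symm y, ⟨_, rfl⟩, by simp⟩
  unfold mult
  rw [← h]
  exact (LinearEquiv.finrank_map_eq (f.restrictScalars K) _).symm

/-- Left exactness of M ↦ `e k • M`: an element of the kernel fixed by `e k` already lies in `e k •
ker f`. -/
theorem finrank_ker_comp_vertexSpace {k : ι} (hk : IsIdempotentElem (e k)) (f : M →ₗ[A] M') :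
    Module.finrank K
      (LinearMap.ker ((f.restrictScalars K).comp (vertexSpace K e M k).subtype)) =
      mult K e (LinearMap.ker f) k := by
  have h : (LinearMap.ker ((f.restrictScalars K).comp (vertexSpace K e M k).subtype)).map
      (vertexSpace K e M k).subtype =
      (vertexSpace K e (LinearMap.ker f) k).map ((LinearMap.ker f).subtype.restrictScalars K) := by
    ext x
    simp only [Submodule.mem_map, LinearMap.mem_ker]
    constructor
    · rintro ⟨⟨y, hy⟩, hy', rfl⟩
      exact ⟨⟨y, hy'⟩, (mem_vertexSpace_iff hk _).2 (Subtype.ext ((mem_vertexSpace_iff hk _).1 hy)),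
        rfl⟩
    · rintro ⟨⟨y, hy'⟩, hy, rfl⟩
      exact ⟨⟨y, (mem_vertexSpace_iff hk _).2
        (congrArg Subtype.val ((mem_vertexSpace_iff hk _).1 hy))⟩, hy', rfl⟩
  unfold mult
  rw [(Submodule.equivMapOfInjective _ (Submodule.subtype_injective _) _).finrank_eq, h,
    ← (Submodule.equivMapOfInjective _ (show Function.Injective
      ((LinearMap.ker f).subtype.restrictScalars K) from Subtype.val_injective) _).finrank_eq]

theorem mult_eq_ker_add [FiniteDimensional K M] {k : ι} (hk : IsIdempotentElem (e k))
    {f : M →ₗ[A] M'} (hf : Function.Surjective f) :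
    mult K e M k = mult K e (LinearMap.ker f) k + mult K e M' k := by
  have h : LinearMap.range ((f.restrictScalars K).comp (vertexSpace K e M k).subtype) =
      vertexSpace K e M' k := by
    ext x
    simp only [LinearMap.mem_range, mem_vertexSpace]
    constructor
    · rintro ⟨⟨_, y, rfl⟩, rfl⟩
      exact ⟨f y, (map_smul f _ _).symm⟩
    · rintro ⟨y, rfl⟩
      obtain ⟨z, rfl⟩ := hf y
      exact ⟨⟨e k • z, z, rfl⟩, map_smul f _ _⟩
  have := LinearMap.finrank_range_add_finrank_ker
    ((f.restrictScalars K).comp (vertexSpace K e M k).subtype)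
  rw [h, finrank_ker_comp_vertexSpace hk] at this
  unfold mult at *
  omega

theorem mult_eq_add_quotient [FiniteDimensional K M] {k : ι} (hk : IsIdempotentElem (e k))
    (N : Submodule A M) : mult K e M k = mult K e N k + mult K e (M ⧸ N) k := by
  rw [mult_eq_ker_add hk N.mkQ_surjective,
    mult_eq_of_equiv (LinearEquiv.ofEq _ _ N.ker_mkQ)]

theorem mult_le_of_surjective [FiniteDimensional K M] {k : ι} (hk : IsIdempotentElem (e k))
    {f : M →ₗ[A] M'} (hf : Function.Surjective f) : mult K e M' k ≤ mult K e M k := by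
  rw [mult_eq_ker_add hk hf]
  exact Nat.le_add_left _ _

theorem mult_range_of_injective {f : M →ₗ[A] M'} (hf : Function.Injective f) (k : ι) :
    mult K e (LinearMap.range f) k = mult K e M k :=
  (mult_eq_of_equiv (LinearEquiv.ofInjective f hf) k).symm

theorem mult_submodule_le [FiniteDimensional K M] {k : ι} (hk : IsIdempotentElem (e k))
    (N : Submodule A M) : mult K e N k ≤ mult K e M k := by
  rw [mult_eq_add_quotient hk N]
  exact Nat.le_add_right _ _

theorem mult_eq_zero_of_subsingleton [Subsingleton M] (k : ι) : mult K e M k = 0 :=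
  Module.finrank_zero_of_subsingleton

theorem finiteDimensional_submodule [FiniteDimensional K M] (N : Submodule A M) :
    FiniteDimensional K N :=
  inferInstanceAs (FiniteDimensional K (N.restrictScalars K))

theorem finiteDimensional_quotient [FiniteDimensional K M] (N : Submodule A M) :
    FiniteDimensional K (M ⧸ N) :=
  Module.Finite.of_surjective (N.mkQ.restrictScalars K) N.mkQ_surjective

theorem mult_quotient_eq_zero_iff [FiniteDimensional K M] (N : Submodule A M) (k : ι) :
    mult K e (M ⧸ N) k = 0 ↔ ∀ x : M, e k • x ∈ N := by
  have := finiteDimensional_quotient (K := K) N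
  rw [mult_eq_zero_iff]
  constructor
  · intro h x
    exact (Submodule.Quotient.mk_eq_zero N).1 (h (Submodule.Quotient.mk x))
  · intro h y
    obtain ⟨x, rfl⟩ := N.mkQ_surjective y
    exact (Submodule.Quotient.mk_eq_zero N).2 (h x)

theorem mult_submodule_eq_zero_iff [FiniteDimensional K M] (N : Submodule A M) (k : ι) :
    mult K e N k = 0 ↔ ∀ x ∈ N, e k • x = 0 := by
  have := finiteDimensional_submodule (K := K) N
  rw [mult_eq_zero_iff]
  exact ⟨fun h x hx => congrArg Subtype.val (h ⟨x, hx⟩), fun h x => Subtype.ext (h x.1 x.2)⟩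

/-- A submodule of full multiplicity at `k` contains `e k • M`. -/
theorem smul_mem_of_mult_le [FiniteDimensional K M] {k : ι} (hk : IsIdempotentElem (e k))
    {N : Submodule A M} (h : mult K e M k ≤ mult K e N k) (x : M) : e k • x ∈ N := by
  rw [mult_eq_add_quotient hk N] at h
  exact (mult_quotient_eq_zero_iff (K := K) N k).1 (by omega) x

theorem mult_eq_add_subquot [FiniteDimensional K M] {k : ι} (hk : IsIdempotentElem (e k))
    {N N' : Submodule A M} (h : N' ≤ N) :
    mult K e N k = mult K e N' k + mult K e (Subquot N N') k := by
  have := finiteDimensional_submodule (K := K) N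
  rw [mult_eq_add_quotient hk (N'.submoduleOf N),
    mult_eq_of_equiv (Submodule.submoduleOfEquivOfLe h)]

theorem mult_top (k : ι) : mult K e (⊤ : Submodule A M) k = mult K e M k :=
  mult_eq_of_equiv Submodule.topEquiv k

theorem smul_mem_of_mult_le_of_le [FiniteDimensional K M] {k : ι} (hk : IsIdempotentElem (e k))
    {N N' : Submodule A M} (hN : N' ≤ N) (h : mult K e N k ≤ mult K e N' k) {x : M}
    (hx : x ∈ N) : e k • x ∈ N' := by
  have := finiteDimensional_submodule (K := K) N
  rw [← mult_eq_of_equiv (Submodule.submoduleOfEquivOfLe hN)] at h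
  exact smul_mem_of_mult_le hk h (⟨x, hx⟩ : N)

theorem mem_of_forall_smul_mem [Fintype ι] (he : CompleteOrthogonalIdempotents e)
    {N : Submodule A M} {x : M} (h : ∀ k, e k • x ∈ N) : x ∈ N := by
  rw [← one_smul A x, ← he.complete, Finset.sum_smul]
  exact N.sum_mem fun k _ => h k

/-- As the `e k` sum to 1, a submodule is determined by its vertex spaces. This and the next two
lemmas turn numerical equalities into equalities and isomorphisms of modules. -/
theorem eq_of_le_of_mult_le [Fintype ι] (he : CompleteOrthogonalIdempotents e)
    [FiniteDimensional K M] {N N' : Submodule A M} (hN : N' ≤ N)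
    (h : ∀ k, mult K e N k ≤ mult K e N' k) : N' = N :=
  le_antisymm hN fun _ hx => mem_of_forall_smul_mem he fun k =>
    smul_mem_of_mult_le_of_le (K := K) (he.idem k) hN (h k) hx

theorem injective_of_mult_le [Fintype ι] (he : CompleteOrthogonalIdempotents e)
    [FiniteDimensional K M] {f : M →ₗ[A] M'} (hf : Function.Surjective f)
    (h : ∀ k, mult K e M k ≤ mult K e M' k) : Function.Injective f := by
  rw [← LinearMap.ker_eq_bot]
  refine (Submodule.eq_bot_iff _).2 fun x hx => ?_
  refine (Submodule.mem_bot A).1 ?_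
  refine mem_of_forall_smul_mem he fun k => (Submodule.mem_bot A).2 ?_
  have := mult_eq_ker_add (K := K) (he.idem k) hf
  have := h k
  exact (mult_submodule_eq_zero_iff (K := K) (LinearMap.ker f) k).1 (by omega) x hx

theorem surjective_of_mult_le [Fintype ι] (he : CompleteOrthogonalIdempotents e)
    [FiniteDimensional K M'] {f : M →ₗ[A] M'} (hf : Function.Injective f)
    (h : ∀ k, mult K e M' k ≤ mult K e M k) : Function.Surjective f := by
  rw [← LinearMap.range_eq_top]
  refine eq_of_le_of_mult_le (K := K) he le_top fun k => ?_
  rw [mult_top, mult_range_of_injective hf]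
  exact h k

theorem mult_eq_sum_subquot [FiniteDimensional K M] {k : ι} (hk : IsIdempotentElem (e k))
    {n : ℕ} (F : Fin (n + 1) → Submodule A M) (hF : ∀ t : Fin n, F t.castSucc ≤ F t.succ) :
    mult K e (F (Fin.last n)) k = mult K e (F 0) k +
      ∑ t : Fin n, mult K e (Subquot (F t.succ) (F t.castSucc)) k := by
  induction n with
  | zero => simp
  | succ n ih =>
    rw [Fin.sum_univ_castSucc, ← add_assoc]
    have := ih (fun t => F t.castSucc) (fun t => hF t.castSucc)
    rw [Fin.castSucc_zero] at this
    rw [show Fin.last (n + 1) = (Fin.last n).succ from rfl,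
      mult_eq_add_subquot hk (hF (Fin.last n)), this]
    rfl

end Mult

/-! ### The modules P(i) are local; simple modules live at one vertex -/

section Projective

variable {K A ι : Type*} [Field K] [Ring A] [Algebra K A] {e : ι → A}
variable {M : Type*} [AddCommGroup M] [Module A M]

theorem mem_proj_iff {i : ι} (hi : IsIdempotentElem (e i)) (a : A) :
    a ∈ Proj e i ↔ a * e i = a := by
  rw [Submodule.mem_span_singleton]
  constructor
  · rintro ⟨b, rfl⟩
    rw [smul_eq_mul, mul_assoc, hi.eq]
  · exact fun h => ⟨a, h⟩

/-- The generator `e i` of `P(i)`. -/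
def projGen (e : ι → A) (i : ι) : Proj e i :=
  ⟨e i, Submodule.mem_span_singleton_self _⟩

theorem smul_projGen {i : ι} (hi : IsIdempotentElem (e i)) (a : Proj e i) :
    (a : A) • projGen e i = a :=
  Subtype.ext ((mem_proj_iff hi _).1 a.2)

/-- The homomorphism `P(i) → M` sending `a` to `a • x`. -/
def projHom (e : ι → A) (i : ι) (x : M) : Proj e i →ₗ[A] M :=
  (LinearMap.toSpanSingleton A M x).comp (Proj e i).subtype

@[simp] theorem projHom_apply (i : ι) (x : M) (a : Proj e i) :
    projHom e i x a = (a : A) • x := rfl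

theorem map_proj {i : ι} (hi : IsIdempotentElem (e i)) (f : Proj e i →ₗ[A] M) (a : Proj e i) :
    f a = (a : A) • f (projGen e i) := by
  rw [← map_smul, smul_projGen hi]

theorem smul_map_projGen {i : ι} (hi : IsIdempotentElem (e i)) (f : Proj e i →ₗ[A] M) :
    e i • f (projGen e i) = f (projGen e i) :=
  (map_proj hi f (projGen e i)).symm

theorem projGen_ne_zero {i : ι} (hi : IsPrimitive (e i)) : projGen e i ≠ 0 :=
  fun h => hi.2.1 (congrArg Subtype.val h)

theorem eq_top_of_projGen_mem {i : ι} (hi : IsIdempotentElem (e i)) {N : Submodule A (Proj e i)}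
    (h : projGen e i ∈ N) : N = ⊤ := by
  refine Submodule.eq_top_iff'.2 fun a => ?_
  rw [← smul_projGen hi a]
  exact N.smul_mem _ h

/-- The components of the generator `e i` along a decomposition are orthogonal idempotents with sum
`e i`, so primitivity kills one of them. -/
theorem proj_eq_bot_or_eq_top_of_isCompl {i : ι} (hi : IsPrimitive (e i))
    {U V : Submodule A (Proj e i)} (h : IsCompl U V) : U = ⊥ ∨ V = ⊥ := by
  have hd : ∀ x, x ∈ U → x ∈ V → x = 0 := fun x hx hy =>
    (Submodule.mem_bot A).1 (h.disjoint.le_bot ⟨hx, hy⟩)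
  have hs : projGen e i ∈ U ⊔ V := by rw [h.sup_eq_top]; trivial
  obtain ⟨u, hu, v, hv, huv⟩ := Submodule.mem_sup.1 hs
  have huv' : (u : A) + v = e i := congrArg Subtype.val huv
  have h1 : ∀ w : Proj e i, (w : A) * u + w * v = w := fun w => by
    rw [← mul_add, huv', (mem_proj_iff hi.1 _).1 w.2]
  -- From u = u·u + u·v, the product u·v lies in U as well as in V.
  have huvz : (u : A) • v = 0 := by
    refine hd _ ?_ (V.smul_mem _ hv)
    have : (u : A) • v = u - (u : A) • u := Subtype.ext (eq_sub_of_add_eq' (h1 u))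
    rw [this]
    exact U.sub_mem hu (U.smul_mem _ hu)
  have hvuz : (v : A) • u = 0 := by
    refine hd _ (U.smul_mem _ hu) ?_
    have : (v : A) • u = v - (v : A) • v := Subtype.ext (eq_sub_of_add_eq (h1 v))
    rw [this]
    exact V.sub_mem hv (V.smul_mem _ hv)
  have huv0 : (u : A) * v = 0 := congrArg Subtype.val huvz
  have hvu0 : (v : A) * u = 0 := congrArg Subtype.val hvuz
  have hu2 : IsIdempotentElem (u : A) := by
    have := h1 u
    rwa [huv0, add_zero] at this
  have hv2 : IsIdempotentElem (v : A) := by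
    have := h1 v
    rwa [hvu0, zero_add] at this
  rcases hi.2.2 u v hu2 hv2 huv0 hvu0 huv'.symm with h0 | h0
  · left
    have : u = 0 := Subtype.ext h0
    rw [this, zero_add] at huv
    have hV := eq_top_of_projGen_mem hi.1 (huv ▸ hv)
    have := h.inf_eq_bot
    rwa [hV, inf_top_eq] at this
  · right
    have : v = 0 := Subtype.ext h0
    rw [this, add_zero] at huv
    have hU := eq_top_of_projGen_mem hi.1 (huv ▸ hu)
    have := h.inf_eq_bot
    rwa [hU, top_inf_eq] at this

theorem isArtinian_of_finiteDimensional (K : Type*) {A M : Type*} [Field K] [Ring A] [Algebra K A]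
    [AddCommGroup M] [Module K M] [Module A M] [IsScalarTower K A M] [FiniteDimensional K M] :
    IsArtinian A M ∧ IsNoetherian A M :=
  ⟨isArtinian_of_tower K inferInstance, isNoetherian_of_tower K inferInstance⟩

theorem finiteDimensional_proj (K : Type*) {A ι : Type*} [Field K] [Ring A] [Algebra K A]
    [FiniteDimensional K A] (e : ι → A) (i : ι) : FiniteDimensional K (Proj e i) :=
  finiteDimensional_submodule (Proj e i)

/-- Fitting's lemma for `P(i)`. -/
theorem isNilpotent_or_bijective (K : Type*) [Field K] [Algebra K A] [FiniteDimensional K A]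
    {i : ι} (hi : IsPrimitive (e i)) (f : Proj e i →ₗ[A] Proj e i) :
    (∃ n, f ^ n = 0) ∨ Function.Bijective f := by
  have := finiteDimensional_proj K e i
  obtain ⟨_, _⟩ := isArtinian_of_finiteDimensional K (A := A) (M := Proj e i)
  obtain ⟨n, hn⟩ := Filter.eventually_atTop.1 (LinearMap.eventually_isCompl_ker_pow_range_pow f)
  -- A positive exponent is taken so that injectivity of the power yields injectivity of f.
  have h := hn (n + 1) (Nat.le_succ n)
  rcases proj_eq_bot_or_eq_top_of_isCompl hi h with h0 | h0
  · right
    have hinj : Function.Injective f := by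
      have := LinearMap.ker_eq_bot.1 h0
      rw [pow_succ, Module.End.mul_eq_comp, LinearMap.coe_comp] at this
      exact this.of_comp
    exact ⟨hinj, IsArtinian.surjective_of_injective_endomorphism f hinj⟩
  · exact Or.inl ⟨n + 1, LinearMap.range_eq_bot.1 h0⟩

/-- `P(i)` is a local module. -/
theorem proj_sup_ne_top (K : Type*) [Field K] [Algebra K A] [FiniteDimensional K A]
    {i : ι} (hi : IsPrimitive (e i)) {N N' : Submodule A (Proj e i)} (hN : N ≠ ⊤) (hN' : N' ≠ ⊤) :
    N ⊔ N' ≠ ⊤ := by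
  intro h
  have hs : projGen e i ∈ N ⊔ N' := by rw [h]; trivial
  obtain ⟨u, hu, v, hv, huv⟩ := Submodule.mem_sup.1 hs
  have hrange : ∀ w : Proj e i, LinearMap.range (projHom e i w) ≤ Submodule.span A {w} := by
    rintro w _ ⟨a, rfl⟩
    exact Submodule.smul_mem _ _ (Submodule.mem_span_singleton_self w)
  -- Right multiplications by u and v add up to the identity of P(i); if one is nilpotent, the other
  -- is invertible.
  have hsum : projHom e i u = 1 - projHom e i v := by
    ext a
    have : (a : A) * u + a * v = a := by
      have : (u : A) + v = e i := congrArg Subtype.val huv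
      rw [← mul_add, this, (mem_proj_iff hi.1 _).1 a.2]
    exact eq_sub_of_add_eq this
  have key : ∀ w : Proj e i, ∀ W : Submodule A (Proj e i), w ∈ W → Function.Surjective (projHom e i w) →
      W = ⊤ := by
    intro w W hw hsurj
    refine eq_top_iff.2 ?_
    rw [← LinearMap.range_eq_top.2 hsurj]
    exact (hrange w).trans ((Submodule.span_singleton_le_iff_mem _ _).2 hw)
  rcases isNilpotent_or_bijective K hi (projHom e i v) with ⟨n, hn⟩ | hb
  · have hunit : IsUnit (projHom e i u : Module.End A (Proj e i)) := by
      rw [hsum]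
      exact IsNilpotent.isUnit_one_sub ⟨n, hn⟩
    exact hN (key u N hu ((Module.End.isUnit_iff _).1 hunit).2)
  · exact hN' (key v N' hv hb.2)

theorem proj_le_jacobson (K : Type*) [Field K] [Algebra K A] [FiniteDimensional K A]
    {i : ι} (hi : IsPrimitive (e i)) {N : Submodule A (Proj e i)} (hN : N ≠ ⊤) :
    N ≤ Module.jacobson A (Proj e i) := by
  refine le_sInf fun C hC => ?_
  by_contra h
  exact proj_sup_ne_top K hi hN hC.1 (hC.2 _ (right_lt_sup.2 h))

theorem projGen_notMem_jacobson (K : Type*) [Field K] [Algebra K A] [FiniteDimensional K A]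
    {i : ι} (hi : IsPrimitive (e i)) : projGen e i ∉ Module.jacobson A (Proj e i) := by
  have := finiteDimensional_proj K e i
  have : Module.Finite A (Proj e i) := Module.Finite.of_restrictScalars_finite K A _
  have : Nontrivial (Proj e i) := ⟨_, _, projGen_ne_zero hi⟩
  exact fun h => (Module.jacobson_lt_top A (Proj e i)).ne (eq_top_of_projGen_mem hi.1 h)

theorem isSimpleModule_simp (K : Type*) [Field K] [Algebra K A] [FiniteDimensional K A]
    {i : ι} (hi : IsPrimitive (e i)) : IsSimpleModule A (Simp e i) := by
  rw [isSimpleModule_iff_isCoatom]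
  refine ⟨fun h => projGen_notMem_jacobson K hi (h ▸ Submodule.mem_top), fun N hN => ?_⟩
  by_contra h
  exact hN.not_ge (proj_le_jacobson K hi h)

theorem exists_smul_ne_zero_simp (K : Type*) [Field K] [Algebra K A] [FiniteDimensional K A]
    {i : ι} (hi : IsPrimitive (e i)) : ∃ x : Simp e i, e i • x ≠ 0 := by
  refine ⟨Submodule.Quotient.mk (projGen e i), fun h => projGen_notMem_jacobson K hi ?_⟩
  rw [← smul_projGen hi.1 (projGen e i)]
  exact (Submodule.Quotient.mk_eq_zero _).1 h

/-- An endomorphism of P(i) is right multiplication by the image of `e i`. If that image fixes a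
nonzero vector, so do the images of `e i` under all powers of f, which excludes nilpotency;
Fitting's lemma does the rest. -/
theorem bijective_of_smul_eq (K : Type*) [Field K] [Algebra K A] [FiniteDimensional K A]
    {i : ι} (hi : IsPrimitive (e i)) (f : Proj e i →ₗ[A] Proj e i) {z : M} (hz : z ≠ 0)
    (hiz : e i • z = z) (hf : (f (projGen e i) : A) • z = z) : Function.Bijective f := by
  refine (isNilpotent_or_bijective K hi f).resolve_left ?_
  rintro ⟨n, hn⟩
  have hpow : ∀ n : ℕ, (((f ^ n : Module.End A (Proj e i)) (projGen e i) : Proj e i) : A) • z =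
      z := by
    intro n
    induction n with
    | zero => exact hiz
    | succ n ih =>
      rw [pow_succ', Module.End.mul_apply, map_proj hi.1 f, Submodule.coe_smul, smul_eq_mul,
        mul_smul, hf, ih]
  have := hpow n
  rw [hn] at this
  exact hz (by simpa using this.symm)

/-- A simple module is supported at one vertex only. -/
theorem eq_of_smul_ne_zero (K : Type*) [Field K] [Algebra K A] [FiniteDimensional K A]
    [Fintype ι] (he : IsBasicSystem e) [IsSimpleModule A M] {i l : ι} {x y : M}
    (hx : e i • x ≠ 0) (hy : e l • y ≠ 0) : i = l := by
  obtain ⟨a, ha⟩ := Submodule.mem_span_singleton.1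
    ((IsSimpleModule.span_singleton_eq_top A hx).symm ▸ Submodule.mem_top : e l • y ∈ _)
  obtain ⟨b, hb⟩ := Submodule.mem_span_singleton.1
    ((IsSimpleModule.span_singleton_eq_top A hy).symm ▸ Submodule.mem_top : e i • x ∈ _)
  have hii : e i • e i • x = e i • x := by rw [← mul_smul, (he.complete.idem i).eq]
  have hll : e l • e l • y = e l • y := by rw [← mul_smul, (he.complete.idem l).eq]
  -- The scalars a and b that carry `e i • x` and `e l • y` to each other define maps P(i) → P(l) →
  -- P(i) whose composites fix these vectors. Both composites are bijective, so P(i) ≅ P(l), and i =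
  -- l because the algebra is basic.
  have hφ : ((projHom e i (b • projGen e l) (projGen e i) : Proj e l) : A) • e l • y =
      e i • x := by
    change (e i * (b * e l)) • e l • y = e i • x
    rw [mul_smul, mul_smul, hll, hb, hii]
  have hψ : ((projHom e l (a • projGen e i) (projGen e l) : Proj e i) : A) • e i • x =
      e l • y := by
    change (e l * (a * e i)) • e i • x = e l • y
    rw [mul_smul, mul_smul, hii, ha, hll]
  generalize projHom e i (b • projGen e l) = φ at hφ
  generalize projHom e l (a • projGen e i) = ψ at hψ
  have h1 : Function.Bijective (ψ.comp φ) := by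
    refine bijective_of_smul_eq K (he.primitive i) _ hx hii ?_
    rw [LinearMap.comp_apply, map_proj (he.complete.idem l) ψ, Submodule.coe_smul, smul_eq_mul,
      mul_smul, hψ, hφ]
  have h2 : Function.Bijective (φ.comp ψ) := by
    refine bijective_of_smul_eq K (he.primitive l) _ hy hll ?_
    rw [LinearMap.comp_apply, map_proj (he.complete.idem i) φ, Submodule.coe_smul, smul_eq_mul,
      mul_smul, hφ, hψ]
  rw [LinearMap.coe_comp] at h1 h2
  exact he.basic i l ⟨LinearEquiv.ofBijective φ ⟨h1.1.of_comp, h2.2.of_comp⟩⟩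

end Projective

/-! ### Multiplicities of Δ(i) and P(j) -/

section Counting

open scoped Classical

variable {K A ι : Type*} [Field K] [Ring A] [Algebra K A] [FiniteDimensional K A]
  [Fintype ι] [PartialOrder ι] [BoundedOrder ι] {e : ι → A}
variable {M : Type*} [AddCommGroup M] [Module K M] [Module A M] [IsScalarTower K A M]

theorem mult_std (hA : IsOneQuasiHereditary K e) (i k : ι) :
    mult K e (Std K e i) k = if k ≤ i then 1 else 0 := by
  split_ifs with h
  · exact hA.std_mult i k h
  · exact (stdKer_isLeast K e i).1 k h

/-- The label i is recovered as the greatest vertex in the support of X(i). -/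
theorem eq_of_mult_eq_ite {X : ι → Type*} [∀ i, AddCommGroup (X i)] [∀ i, Module A (X i)]
    [∀ i, Module K (X i)] [∀ i, IsScalarTower K A (X i)]
    (hX : ∀ i k, mult K e (X i) k = if k ≤ i then 1 else 0) {i l : ι}
    (f : X i ≃ₗ[A] X l) : i = l := by
  have h : ∀ k, k ≤ i ↔ k ≤ l := fun k => by
    have := mult_eq_of_equiv (K := K) (e := e) f k
    rw [hX, hX] at this
    split_ifs at this <;> tauto
  exact le_antisymm ((h i).1 le_rfl) ((h l).2 le_rfl)

theorem eq_of_forall_sum_eq {c d : ι → ℕ}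
    (h : ∀ k, ∑ i with k ≤ i, c i = ∑ i with k ≤ i, d i) : c = d := by
  funext k
  induction k using WellFoundedGT.induction with
  | ind k ih =>
    have hk : k ∈ Finset.univ.filter (k ≤ ·) := by simp
    have := h k
    rw [← Finset.add_sum_erase _ _ hk, ← Finset.add_sum_erase _ _ hk] at this
    have h2 : ∑ i ∈ (Finset.univ.filter (k ≤ ·)).erase k, c i =
        ∑ i ∈ (Finset.univ.filter (k ≤ ·)).erase k, d i := by
      refine Finset.sum_congr rfl fun i hi => ih i ?_
      simp only [Finset.mem_erase, Finset.mem_filter, Finset.mem_univ, true_and] at hi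
      exact lt_of_le_of_ne hi.2 (Ne.symm hi.1)
    omega

theorem mult_eq_sum_card (he : IsBasicSystem e) (hA : IsOneQuasiHereditary K e)
    [FiniteDimensional K M] {F : LTSeries (Submodule A M)}
    (hF : IsGoodFiltration (fun i => Std K e i) F) (k : ι) :
    mult K e M k = ∑ i with k ≤ i, Nat.card {t : Fin F.length //
      Nonempty (Subquot (F t.succ) (F t.castSucc) ≃ₗ[A] Std K e i)} := by
  choose lab hlab using hF.subquot
  have hiff : ∀ t i, Nonempty (Subquot (F t.succ) (F t.castSucc) ≃ₗ[A] Std K e i) ↔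
      lab t = i := by
    intro t i
    constructor
    · rintro ⟨f⟩
      obtain ⟨g⟩ := hlab t
      exact eq_of_mult_eq_ite (X := fun i => Std K e i) (mult_std hA) (g.symm.trans f)
    · rintro rfl
      exact hlab t
  have h := mult_eq_sum_subquot (K := K) (e := e) (he.complete.idem k) F.toFun
    (fun t => (F.step t).le)
  have h0 : F.toFun 0 = ⊥ := hF.head
  have h1 : F.toFun (Fin.last F.length) = ⊤ := hF.last
  rw [h0, h1, mult_top, mult_eq_zero_of_subsingleton (M := (⊥ : Submodule A M)), zero_add] at h
  have hterm : ∀ t : Fin F.length, mult K e (Subquot (F.toFun t.succ) (F.toFun t.castSucc)) k =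
      if k ≤ lab t then 1 else 0 := fun t => by
    rw [mult_eq_of_equiv (hlab t).some, mult_std hA]
  rw [h, Finset.sum_congr rfl fun t _ => hterm t, Finset.sum_filter,
    ← Finset.sum_fiberwise (Finset.univ) lab]
  refine Finset.sum_congr rfl fun i _ => ?_
  simp only [hiff]
  rw [Nat.card_eq_fintype_card, Fintype.card_subtype, Finset.card_eq_sum_ones]
  split_ifs with hk
  · refine Finset.sum_congr rfl fun t ht => if_pos ?_
    rw [(Finset.mem_filter.1 ht).2]
    exact hk
  · refine Finset.sum_eq_zero fun t ht => if_neg ?_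
    rw [(Finset.mem_filter.1 ht).2]
    exact hk

/-- `FiltMult` only asserts that some filtration has the given count, and different hypotheses may
provide different filtrations. The matrix [Δ(i):S(k)] is unitriangular, so the composition factors
of M determine all counts. -/
theorem filtMult_unique (he : IsBasicSystem e) (hA : IsOneQuasiHereditary K e)
    [FiniteDimensional K M] {i : ι} {m m' : ℕ} (h : FiltMult A M (fun i => Std K e i) i m)
    (h' : FiltMult A M (fun i => Std K e i) i m') : m = m' := by
  obtain ⟨F, hF, rfl⟩ := h
  obtain ⟨F', hF', rfl⟩ := h'
  exact congrFun (eq_of_forall_sum_eq fun k =>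
    (mult_eq_sum_card he hA hF k).symm.trans (mult_eq_sum_card he hA hF' k)) i

theorem card_subquot_eq (he : IsBasicSystem e) (hA : IsOneQuasiHereditary K e) {j : ι}
    {F : LTSeries (Submodule A (Proj e j))}
    (hF : IsGoodFiltration (fun i => Std K e i) F) (i : ι) :
    Nat.card {t : Fin F.length //
      Nonempty (Subquot (F t.succ) (F t.castSucc) ≃ₗ[A] Std K e i)} = if j ≤ i then 1 else 0 := by
  have := finiteDimensional_proj K e j
  refine filtMult_unique (K := K) (M := Proj e j) (i := i) he hA ⟨F, hF, rfl⟩ ?_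
  split_ifs with h
  · exact hA.proj_mult i j h
  · exact hA.proj_std_eq_zero j i h

theorem mult_proj (he : IsBasicSystem e) (hA : IsOneQuasiHereditary K e) (j k : ι) :
    mult K e (Proj e j) k = (Finset.univ.filter fun l => j ≤ l ∧ k ≤ l).card := by
  have := finiteDimensional_proj K e j
  obtain ⟨F, hF, -⟩ := hA.proj_std_self j
  rw [mult_eq_sum_card he hA hF, Finset.sum_congr rfl fun i _ => card_subquot_eq he hA hF i,
    Finset.sum_filter, Finset.card_filter]
  refine Finset.sum_congr rfl fun i _ => ?_
  split_ifs <;> tauto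

theorem mult_proj_of_le (he : IsBasicSystem e) (hA : IsOneQuasiHereditary K e) {j k : ι}
    (h : j ≤ k) :
    mult K e (Proj e j) k = (Finset.univ.filter fun l => k ≤ l).card := by
  rw [mult_proj he hA]
  congr 1
  ext l
  simpa using fun hl => h.trans hl

end Counting

/-! ### Traces and rejects of sets of vertices -/

section TraceReject

variable {A ι : Type*} [Ring A] {e : ι → A}
variable {M M' : Type*} [AddCommGroup M] [Module A M] [AddCommGroup M'] [Module A M']

/-- The trace of the projectives `P(l)`, `l ∈ U`, in `M`. -/
def trace (e : ι → A) (U : Set ι) (M : Type*) [AddCommGroup M] [Module A M] : Submodule A M :=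
  Submodule.span A {x | ∃ l ∈ U, ∃ y : M, e l • y = x}

theorem smul_mem_trace {U : Set ι} {l : ι} (hl : l ∈ U) (x : M) : e l • x ∈ trace e U M :=
  Submodule.subset_span ⟨l, hl, x, rfl⟩

theorem trace_le_iff {U : Set ι} {N : Submodule A M} :
    trace e U M ≤ N ↔ ∀ l ∈ U, ∀ x : M, e l • x ∈ N := by
  unfold trace
  rw [Submodule.span_le]
  constructor
  · exact fun h l hl x => h ⟨l, hl, x, rfl⟩
  · rintro h _ ⟨l, hl, x, rfl⟩
    exact h l hl x

theorem trace_mono {U V : Set ι} (h : U ⊆ V) : trace e U M ≤ trace e V M :=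
  trace_le_iff.2 fun _ hl x => smul_mem_trace (h hl) x

theorem trace_map_le (U : Set ι) (f : M →ₗ[A] M') : (trace e U M).map f ≤ trace e U M' := by
  rw [Submodule.map_le_iff_le_comap, trace_le_iff]
  intro l hl x
  rw [Submodule.mem_comap, map_smul]
  exact smul_mem_trace hl _

theorem trace_map_of_surjective (U : Set ι) {f : M →ₗ[A] M'} (hf : Function.Surjective f) :
    (trace e U M).map f = trace e U M' := by
  refine le_antisymm (trace_map_le U f) (trace_le_iff.2 fun l hl x => ?_)
  obtain ⟨y, rfl⟩ := hf x
  exact ⟨e l • y, smul_mem_trace hl y, map_smul f _ _⟩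

theorem trace_iUnion {κ : Sort*} (U : κ → Set ι) :
    trace e (⋃ t, U t) M = ⨆ t, trace e (U t) M := by
  refine le_antisymm (trace_le_iff.2 fun l hl x => ?_)
    (iSup_le fun t => trace_mono (Set.subset_iUnion U t))
  obtain ⟨t, ht⟩ := Set.mem_iUnion.1 hl
  exact Submodule.mem_iSup_of_mem t (smul_mem_trace ht x)

theorem trace_empty : trace e ∅ M = ⊥ :=
  le_bot_iff.1 (trace_le_iff.2 fun _ hl => hl.elim)

theorem trace_proj_self {j : ι} (hj : IsIdempotentElem (e j)) {U : Set ι} (h : j ∈ U) :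
    trace e U (Proj e j) = ⊤ := by
  refine eq_top_of_projGen_mem hj ?_
  rw [← smul_projGen hj (projGen e j)]
  exact smul_mem_trace h _

theorem range_le_trace {i : ι} (hi : IsIdempotentElem (e i)) (f : Proj e i →ₗ[A] M) :
    LinearMap.range f ≤ trace e {i} M := by
  rw [← Submodule.map_top, ← trace_proj_self hi (Set.mem_singleton i)]
  exact trace_map_le _ f

/-- The largest submodule of `M` without composition factors `S(l)`, `l ∈ U`. -/
def reject (e : ι → A) (U : Set ι) (M : Type*) [AddCommGroup M] [Module A M] : Submodule A M where
  carrier := {x | ∀ l ∈ U, ∀ a : A, e l • a • x = 0}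
  zero_mem' := by simp
  add_mem' := fun hx hy l hl a => by rw [smul_add, smul_add, hx l hl, hy l hl, add_zero]
  smul_mem' := fun b x hx l hl a => by rw [← mul_smul a b]; exact hx l hl _

theorem mem_reject {U : Set ι} {x : M} :
    x ∈ reject e U M ↔ ∀ l ∈ U, ∀ a : A, e l • a • x = 0 := Iff.rfl

theorem smul_eq_zero_of_mem_reject {U : Set ι} {x : M} (hx : x ∈ reject e U M) {l : ι}
    (hl : l ∈ U) : e l • x = 0 := by
  simpa using hx l hl 1

theorem le_reject_iff {U : Set ι} {N : Submodule A M} :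
    N ≤ reject e U M ↔ ∀ l ∈ U, ∀ x ∈ N, e l • x = 0 :=
  ⟨fun h _ hl _ hx => smul_eq_zero_of_mem_reject (h hx) hl,
    fun h _ hx l hl a => h l hl _ (N.smul_mem a hx)⟩

theorem reject_anti {U V : Set ι} (h : U ⊆ V) : reject e V M ≤ reject e U M :=
  fun _ hx l hl => hx l (h hl)

theorem reject_iUnion {κ : Sort*} (U : κ → Set ι) :
    reject e (⋃ t, U t) M = ⨅ t, reject e (U t) M := by
  refine le_antisymm (le_iInf fun t => reject_anti (Set.subset_iUnion U t)) fun x hx l hl => ?_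
  obtain ⟨t, ht⟩ := Set.mem_iUnion.1 hl
  exact (Submodule.mem_iInf _).1 hx t l ht

theorem reject_empty : reject e ∅ M = ⊤ :=
  top_le_iff.1 fun _ _ _ hl => hl.elim

theorem reject_map_of_surjective {U : Set ι} {f : M →ₗ[A] M'} (hf : Function.Surjective f)
    (h : LinearMap.ker f ≤ reject e U M) (hU : ∀ l ∈ U, IsIdempotentElem (e l)) :
    (reject e U M).map f = reject e U M' := by
  apply le_antisymm
  · rintro _ ⟨x, hx, rfl⟩ l hl a
    rw [← map_smul, ← map_smul, hx l hl, map_zero]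
  · intro y hy
    obtain ⟨x, rfl⟩ := hf y
    refine ⟨x, fun l hl a => ?_, rfl⟩
    have := hy l hl a
    rw [← map_smul, ← map_smul] at this
    -- The vector `e l • a • x` is only known to lie in the kernel; the kernel is annihilated by `e
    -- l`, and `e l` is idempotent.
    have := smul_eq_zero_of_mem_reject (h this) hl
    rwa [← mul_smul, (hU l hl).eq] at this

end TraceReject

/-! ### The modules I(i) as spaces of linear forms -/

section Injective

variable {K A ι : Type*} [Field K] [Ring A] [Algebra K A] {e : ι → A}
variable {M : Type*} [AddCommGroup M] [Module K M] [Module A M] [IsScalarTower K A M]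

theorem finiteDimensional_inj (K : Type*) {A ι : Type*} [Field K] [Ring A] [Algebra K A]
    [FiniteDimensional K A] (e : ι → A) (i : ι) : FiniteDimensional K (Inj K e i) :=
  inferInstanceAs (FiniteDimensional K (Module.Dual K (rightIdeal K (e i))))

/-- An element of `I(i)` as the linear form `a ↦ φ (e i * a)` on `A`. -/
def Inj.pair {i : ι} (φ : Inj K e i) : A →ₗ[K] K :=
  (show Module.Dual K (rightIdeal K (e i)) from φ).comp (LinearMap.mulLeft K (e i)).rangeRestrict

theorem Inj.pair_smul {i : ι} (φ : Inj K e i) (b a : A) :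
    (b • φ).pair a = φ.pair (a * b) :=
  congrArg (show Module.Dual K (rightIdeal K (e i)) from φ)
    (Subtype.ext (mul_assoc (e i) a b))

theorem Inj.pair_zero {i : ι} (a : A) : (0 : Inj K e i).pair a = 0 := rfl

theorem Inj.pair_mul_left {i : ι} (hi : IsIdempotentElem (e i)) (φ : Inj K e i) (a : A) :
    φ.pair (e i * a) = φ.pair a :=
  congrArg (show Module.Dual K (rightIdeal K (e i)) from φ)
    (Subtype.ext (show e i * (e i * a) = e i * a by rw [← mul_assoc, hi.eq]))

theorem Inj.eq_zero_of_pair {i : ι} {φ : Inj K e i} (h : ∀ a, φ.pair a = 0) : φ = 0 := by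
  apply LinearMap.ext
  rintro ⟨_, a, rfl⟩
  exact h a

/-- Every nonzero submodule of I(i) has S(i) as a factor: evaluating `e i • a • φ` at 1 returns the
value of φ at `e i * a`. -/
theorem reject_inj_self {i : ι} (hi : IsIdempotentElem (e i)) :
    reject e {i} (Inj K e i) = ⊥ := by
  refine (Submodule.eq_bot_iff _).2 fun φ hφ => Inj.eq_zero_of_pair fun a => ?_
  have := congrArg (fun ψ : Inj K e i => ψ.pair 1) (hφ i rfl a)
  simp only [Inj.pair_smul, Inj.pair_zero, one_mul] at this
  rwa [Inj.pair_mul_left hi] at this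

/-- The space `e k • I(j)` is dual to `e j A e k`, which is also the vertex space of P(k) at j. -/
theorem mult_inj_eq {k j : ι} (hk : IsIdempotentElem (e k))
    [FiniteDimensional K A] : mult K e (Inj K e j) k = mult K e (Proj e k) j := by
  have h1 : mult K e (Inj K e j) k =
      Module.finrank K (LinearMap.range (rightMul K (e j) (e k)).dualMap) := rfl
  rw [h1, LinearMap.finrank_range_dualMap_eq_finrank_range]
  have h2 : (LinearMap.range (rightMul K (e j) (e k))).map (rightIdeal K (e j)).subtype =
      (vertexSpace K e (Proj e k) j).map ((Proj e k).subtype.restrictScalars K) := by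
    ext x
    constructor
    · rintro ⟨_, ⟨⟨_, a, rfl⟩, rfl⟩, rfl⟩
      exact ⟨e j • a • projGen e k, ⟨_, rfl⟩, (mul_assoc _ _ _).symm⟩
    · rintro ⟨_, ⟨a, rfl⟩, rfl⟩
      refine ⟨_, ⟨⟨_, (a : A), rfl⟩, rfl⟩, ?_⟩
      change e j * a * e k = e j * a
      rw [mul_assoc, (mem_proj_iff hk _).1 a.2]
  unfold mult
  rw [(Submodule.equivMapOfInjective _ (Submodule.subtype_injective _) _).finrank_eq, h2,
    ← (Submodule.equivMapOfInjective _ (show Function.Injective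
      ((Proj e k).subtype.restrictScalars K) from Subtype.val_injective) _).finrank_eq]

/-- The homomorphism `M → I(i)` attached to a linear form on `M`. -/
def injHom (e : ι → A) (i : ι) (f : M →ₗ[K] K) : M →ₗ[A] Inj K e i where
  toFun m := (show Module.Dual K (rightIdeal K (e i)) from
    (f.comp ((LinearMap.toSpanSingleton A M m).restrictScalars K)).comp
      (rightIdeal K (e i)).subtype)
  map_add' x y := by
    apply LinearMap.ext
    intro a
    exact (congrArg f (smul_add (a : A) x y)).trans (map_add f _ _)
  map_smul' b x := by
    apply LinearMap.ext
    intro a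
    exact congrArg f (mul_smul (a : A) b x).symm

theorem pair_injHom (i : ι) (f : M →ₗ[K] K) (m : M) (a : A) :
    (injHom e i f m).pair a = f ((e i * a) • m) := rfl

end Injective

/-! ### Embeddings P(i) ↪ P(j) and coverings P(⊥) ↠ I(j) -/

section OneQuasiHereditary

open scoped Classical

variable {K A ι : Type*} [Field K] [Ring A] [Algebra K A] [FiniteDimensional K A]
  [Fintype ι] [PartialOrder ι] [BoundedOrder ι] {e : ι → A}

theorem mult_inj (he : IsBasicSystem e) (hA : IsOneQuasiHereditary K e) (j k : ι) :
    mult K e (Inj K e j) k = (Finset.univ.filter fun l => j ≤ l ∧ k ≤ l).card := by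
  rw [mult_inj_eq (he.complete.idem k), mult_proj he hA]
  simp only [and_comm]

theorem mult_inj_of_le (he : IsBasicSystem e) (hA : IsOneQuasiHereditary K e) {j k : ι}
    (h : j ≤ k) : mult K e (Inj K e j) k = (Finset.univ.filter fun l => k ≤ l).card := by
  rw [mult_inj he hA, ← mult_proj he hA, mult_proj_of_le he hA h]

/-- A linear form that is nonzero on `e ⊥ • soc P(j)` gives a map to I(⊥) that does not kill the
simple socle. Its kernel contains no simple submodule, hence vanishes. -/
theorem exists_proj_to_inj_bot (he : IsBasicSystem e) (hA : IsOneQuasiHereditary K e) (j : ι) :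
    ∃ f : Proj e j →ₗ[A] Inj K e (⊥ : ι), Function.Injective f := by
  have := finiteDimensional_proj K e j
  obtain ⟨_, _⟩ := isArtinian_of_finiteDimensional K (A := A) (M := Proj e j)
  obtain ⟨g⟩ := hA.socle_proj j
  have := isSimpleModule_simp K (he.primitive (⊥ : ι))
  have hs : IsSimpleModule A (socle A (Proj e j)) := IsSimpleModule.congr g
  obtain ⟨x, hx⟩ := exists_smul_ne_zero_simp K (he.primitive (⊥ : ι))
  have hy : e ⊥ • g.symm x ≠ 0 := fun h => hx (by
    have := congrArg g h
    rwa [map_smul, g.apply_symm_apply, map_zero] at this)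
  have hy' : e ⊥ • (g.symm x : Proj e j) ≠ 0 := fun h => hy (Subtype.ext h)
  obtain ⟨f, hf⟩ := Module.Projective.exists_dual_ne_zero K hy'
  refine ⟨injHom e ⊥ f, LinearMap.ker_eq_bot.1 ?_⟩
  refine (eq_bot_or_exists_atom_le _).resolve_right ?_
  rintro ⟨T, hT, hle⟩
  have hTs : T ≤ socle A (Proj e j) := le_sSup (isSimpleModule_iff_isAtom.2 hT)
  have hTe : socle A (Proj e j) = T :=
    (((isSimpleModule_iff_isAtom.1 hs).le_iff_eq hT.1).1 hTs).symm
  have hmem := hle (hTe.le (g.symm x).2)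
  have h0 := congrArg (fun ψ : Inj K e ⊥ => ψ.pair 1) (LinearMap.mem_ker.1 hmem)
  simp only [pair_injHom, mul_one, Inj.pair_zero] at h0
  exact hf h0

/-- The generator of the top S(⊥) is lifted to I(j); by Nakayama's argument the lift generates I(j).
-/
theorem exists_proj_bot_to_inj (he : IsBasicSystem e) (hA : IsOneQuasiHereditary K e) (j : ι) :
    ∃ f : Proj e (⊥ : ι) →ₗ[A] Inj K e j, Function.Surjective f := by
  have := finiteDimensional_inj K e j
  have : Module.Finite A (Inj K e j) := Module.Finite.of_restrictScalars_finite K A _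
  obtain ⟨g⟩ := hA.top_inj j
  obtain ⟨y, hy⟩ := Submodule.mkQ_surjective _ (g.symm (Submodule.Quotient.mk (projGen e ⊥)))
  refine ⟨projHom e ⊥ y, ?_⟩
  rw [← LinearMap.range_eq_top]
  by_contra h
  obtain ⟨C, hC, hle⟩ := (eq_top_or_exists_le_coatom _).resolve_left h
  refine hC.1 (Submodule.eq_top_iff'.2 fun z => ?_)
  obtain ⟨a, ha⟩ := Submodule.mkQ_surjective _ (g (Submodule.Quotient.mk z))
  have h1 : z - projHom e ⊥ y a ∈ Module.jacobson A (Inj K e j) := by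
    rw [← Submodule.Quotient.mk_eq_zero, Submodule.Quotient.mk_sub, sub_eq_zero]
    apply g.injective
    change _ = g (Submodule.mkQ _ ((a : A) • y))
    rw [map_smul, hy, map_smul, g.apply_symm_apply, ← ha]
    change _ = Submodule.Quotient.mk ((a : A) • projGen e ⊥)
    rw [smul_projGen (he.complete.idem _)]
    rfl
  have h2 := C.add_mem ((sInf_le hC : Module.jacobson A (Inj K e j) ≤ C) h1) (hle ⟨a, rfl⟩)
  rwa [sub_add_cancel] at h2

theorem exists_proj_to_proj_bot (he : IsBasicSystem e) (hA : IsOneQuasiHereditary K e) (j : ι) :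
    ∃ f : Proj e j →ₗ[A] Proj e (⊥ : ι), Function.Injective f := by
  have := finiteDimensional_proj K e (⊥ : ι)
  obtain ⟨f, hf⟩ := exists_proj_to_inj_bot he hA j
  obtain ⟨g, hg⟩ := exists_proj_bot_to_inj he hA (⊥ : ι)
  have hg' : Function.Injective g := injective_of_mult_le (K := K) he.complete hg fun k => by
    rw [mult_proj he hA, mult_inj he hA]
  exact ⟨(LinearEquiv.ofBijective g ⟨hg', hg⟩).symm.toLinearMap.comp f,
    (LinearEquiv.ofBijective g ⟨hg', hg⟩).symm.injective.comp hf⟩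

/-- Inside P(⊥) the copy of P(j) already contains `e i • P(⊥)`, since both have #{l | i ≤ l} as
multiplicity at i. It therefore contains the generator of the copy of P(i). -/
theorem exists_proj_to_proj (he : IsBasicSystem e) (hA : IsOneQuasiHereditary K e) {i j : ι}
    (h : j ≤ i) : ∃ f : Proj e i →ₗ[A] Proj e j, Function.Injective f := by
  have := finiteDimensional_proj K e (⊥ : ι)
  obtain ⟨f, hf⟩ := exists_proj_to_proj_bot he hA i
  obtain ⟨g, hg⟩ := exists_proj_to_proj_bot he hA j
  have hmem : f (projGen e i) ∈ LinearMap.range g := by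
    rw [← smul_map_projGen (he.complete.idem i)]
    refine smul_mem_of_mult_le (K := K) (he.complete.idem i) ?_ _
    rw [mult_range_of_injective hg, mult_proj_of_le he hA bot_le, mult_proj_of_le he hA h]
  obtain ⟨y, hy⟩ := hmem
  have hcomp : ∀ a, g (projHom e i y a) = f a := fun a => by
    rw [projHom_apply, map_smul, hy, ← map_proj (he.complete.idem i)]
  refine ⟨projHom e i y, fun a b hab => hf ?_⟩
  rw [← hcomp, ← hcomp, hab]

/-- The image has full multiplicity at i, so it contains `e i • P(j)`. The right-hand side does not
mention f, which yields uniqueness of the submodule P(i). -/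
theorem range_eq_trace (he : IsBasicSystem e) (hA : IsOneQuasiHereditary K e) {i j : ι}
    (h : j ≤ i) {f : Proj e i →ₗ[A] Proj e j} (hf : Function.Injective f) :
    LinearMap.range f = trace e {i} (Proj e j) := by
  have := finiteDimensional_proj K e j
  refine le_antisymm (range_le_trace (he.complete.idem i) f) (trace_le_iff.2 ?_)
  rintro _ rfl x
  refine smul_mem_of_mult_le (K := K) (he.complete.idem _) ?_ _
  rw [mult_range_of_injective hf, mult_proj_of_le he hA h, mult_proj_of_le he hA le_rfl]

theorem nonempty_equiv_proj_iff (he : IsBasicSystem e) (hA : IsOneQuasiHereditary K e) {i j : ι}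
    (h : j ≤ i) (N : Submodule A (Proj e j)) :
    Nonempty (N ≃ₗ[A] Proj e i) ↔ N = trace e {i} (Proj e j) := by
  constructor
  · rintro ⟨g⟩
    have hinj : Function.Injective (N.subtype.comp g.symm.toLinearMap) :=
      N.subtype_injective.comp g.symm.injective
    rw [← range_eq_trace he hA h hinj, LinearMap.range_comp, LinearEquiv.range,
      Submodule.map_top, Submodule.range_subtype]
  · rintro rfl
    obtain ⟨f, hf⟩ := exists_proj_to_proj he hA h
    rw [← range_eq_trace he hA h hf]
    exact ⟨(LinearEquiv.ofInjective f hf).symm⟩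

theorem smul_mem_trace_of_le (he : IsBasicSystem e) (hA : IsOneQuasiHereditary K e) {i j k : ι}
    (hij : j ≤ i) (hk : i ≤ k) (x : Proj e j) : e k • x ∈ trace e {i} (Proj e j) := by
  have := finiteDimensional_proj K e j
  obtain ⟨f, hf⟩ := exists_proj_to_proj he hA hij
  rw [← range_eq_trace he hA hij hf]
  refine smul_mem_of_mult_le (K := K) (he.complete.idem k) ?_ x
  rw [mult_range_of_injective hf, mult_proj_of_le he hA (hij.trans hk), mult_proj_of_le he hA hk]

end OneQuasiHereditary

/-! ### Upper sets and a counting principle -/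

section Combinatorics

open scoped Classical

variable {ι : Type*} [Fintype ι] [PartialOrder ι]

/-- `U` is an upper set consisting of elements `≥ j`. -/
def IsUpper (j : ι) (U : Finset ι) : Prop :=
  IsUpperSet (U : Set ι) ∧ ∀ l ∈ U, j ≤ l

theorem IsUpper.erase {j i : ι} {U : Finset ι} (hU : IsUpper j U) (hi : Minimal (· ∈ U) i) :
    IsUpper j (U.erase i) := by
  refine ⟨fun a b hab ha => ?_, fun l hl => hU.2 l (Finset.mem_of_mem_erase hl)⟩
  simp only [Finset.mem_coe, Finset.mem_erase] at ha ⊢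
  refine ⟨?_, hU.1 hab ha.2⟩
  rintro rfl
  exact ha.1 (le_antisymm hab (hi.2 ha.2 hab))

theorem IsUpper.Ioi_subset_erase {j i : ι} {U : Finset ι} (hU : IsUpper j U) (hi : i ∈ U) :
    Set.Ioi i ⊆ (U.erase i : Finset ι) := fun l hl => by
  simp only [Finset.mem_coe, Finset.mem_erase]
  exact ⟨ne_of_gt hl, hU.1 (le_of_lt hl) hi⟩

theorem isUpper_Ici (j : ι) : IsUpper j (Finset.univ.filter (j ≤ ·)) := by
  refine ⟨fun a b hab ha => ?_, fun l hl => (Finset.mem_filter.1 hl).2⟩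
  simp only [Finset.coe_filter, Finset.mem_univ, true_and, Set.mem_ofPred_eq] at ha ⊢
  exact ha.trans hab

theorem exists_minimal_le {U : Finset ι} {k : ι} (hk : k ∈ U) : ∃ l ≤ k, Minimal (· ∈ U) l :=
  U.finite_toSet.exists_le_minimal hk

/-- If each removal of a minimal element costs at most its weight, then f is at most the sum of
weights. Since the whole set {l | j ≤ l} attains the bound, no intermediate upper set can fall short
of it. -/
theorem eq_sum_of_forall_le {j : ι} {f : Finset ι → ℕ} {w : ι → ℕ} (h0 : f ∅ = 0)
    (hstep : ∀ U, IsUpper j U → ∀ i, Minimal (· ∈ U) i → f U ≤ f (U.erase i) + w i)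
    (htop : ∑ l with j ≤ l, w l ≤ f (Finset.univ.filter (j ≤ ·))) {U : Finset ι}
    (hU : IsUpper j U) : f U = ∑ l ∈ U, w l := by
  have hle : ∀ U, IsUpper j U → f U ≤ ∑ l ∈ U, w l := by
    intro U
    induction U using Finset.strongInduction with
    | H U ih =>
      intro hU
      rcases U.eq_empty_or_nonempty with rfl | ⟨k, hk⟩
      · simp [h0]
      · obtain ⟨i, -, hi⟩ := exists_minimal_le hk
        have h1 := ih _ (Finset.erase_ssubset hi.1) (hU.erase hi)
        have h2 := hstep U hU i hi
        rw [← Finset.add_sum_erase _ _ hi.1]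
        omega
  refine le_antisymm (hle U hU) ?_
  induction hn : (Finset.univ.filter (j ≤ ·) \ U).card using Nat.strong_induction_on
    generalizing U with
  | _ n ih =>
    subst hn
    rcases (Finset.univ.filter (j ≤ ·) \ U).eq_empty_or_nonempty with h | ⟨k, hk⟩
    · have : U = Finset.univ.filter (j ≤ ·) := by
        refine Finset.Subset.antisymm (fun l hl => ?_) (Finset.sdiff_eq_empty_iff_subset.1 h)
        simpa using hU.2 l hl
      subst this
      exact htop
    -- Adding a maximal element of the complement keeps U an upper set and makes that element
    -- minimal, so equality descends from the larger set.
    · obtain ⟨l, -, hl⟩ := (Finset.univ.filter (j ≤ ·) \ U).finite_toSet.exists_le_maximal hk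
      have hlU : l ∉ U := (Finset.mem_sdiff.1 hl.1).2
      have hjl : j ≤ l := (Finset.mem_filter.1 (Finset.mem_sdiff.1 hl.1).1).2
      have hup : IsUpper j (insert l U) := by
        refine ⟨fun a b hab ha => ?_, fun a ha => ?_⟩
        · simp only [Finset.coe_insert, Set.mem_insert_iff, Finset.mem_coe] at ha ⊢
          rcases ha with rfl | ha
          · by_contra! hb
            have : b ∈ Finset.univ.filter (j ≤ ·) \ U := by
              simpa using ⟨hjl.trans hab, hb.2⟩
            exact hb.1 (le_antisymm (hl.2 this hab) hab)
          · exact Or.inr (hU.1 hab ha)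
        · rcases Finset.mem_insert.1 ha with rfl | ha
          · exact hjl
          · exact hU.2 a ha
      have hmin : Minimal (· ∈ insert l U) l := by
        refine ⟨Finset.mem_insert_self _ _, fun y hy hyl => ?_⟩
        rcases Finset.mem_insert.1 hy with rfl | hy
        · exact le_rfl
        · exact (hlU (hU.1 hyl hy)).elim
      have h1 := hstep _ hup l hmin
      rw [Finset.erase_insert hlU] at h1
      have h2 := ih _ (Finset.card_lt_card ?_) hup rfl
      · rw [Finset.sum_insert hlU] at h2
        omega
      · refine Finset.ssubset_iff_subset_ne.2 ⟨Finset.sdiff_subset_sdiff le_rfl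
          (Finset.subset_insert _ _), fun h => ?_⟩
        have := h ▸ hl.1
        simp at this

end Combinatorics

/-! ### Removing a minimal vertex from a trace splits off a standard module -/

section StandardStep

open scoped Classical

variable {K A ι : Type*} [Field K] [Ring A] [Algebra K A] [FiniteDimensional K A]
  [Fintype ι] [PartialOrder ι] [BoundedOrder ι] {e : ι → A}
variable {M : Type*} [AddCommGroup M] [Module A M]

theorem finiteDimensional_std (K : Type*) {A ι : Type*} [Field K] [Ring A] [Algebra K A]
    [FiniteDimensional K A] [PartialOrder ι] (e : ι → A) (i : ι) :
    FiniteDimensional K (Std K e i) :=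
  have := finiteDimensional_proj K e i
  finiteDimensional_quotient _

theorem nontrivial_of_mult_ne_zero [Module K M] [IsScalarTower K A M] {k : ι}
    (h : mult K e M k ≠ 0) : Nontrivial M := by
  by_contra hM
  have := not_nontrivial_iff_subsingleton.1 hM
  exact h (mult_eq_zero_of_subsingleton k)

theorem exists_smul_eq_stdGen (he : IsBasicSystem e) {i : ι} (z : Std K e i) :
    ∃ a : A, z = a • (stdKer K e i).mkQ (projGen e i) := by
  obtain ⟨a, rfl⟩ := Submodule.mkQ_surjective _ z
  exact ⟨a, by rw [← map_smul, smul_projGen (he.complete.idem i)]⟩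

theorem smul_stdGen (he : IsBasicSystem e) (i : ι) :
    e i • (stdKer K e i).mkQ (projGen e i) = (stdKer K e i).mkQ (projGen e i) := by
  rw [← map_smul]
  congr 1
  exact smul_projGen (he.complete.idem i) (projGen e i)

/-- `Δ(i)` has a simple quotient, which is supported at `i`. -/
theorem exists_simple_quotient_std (he : IsBasicSystem e) (hA : IsOneQuasiHereditary K e) (i : ι) :
    ∃ C : Submodule A (Std K e i), IsSimpleModule A (Std K e i ⧸ C) ∧
      ∀ {l : ι} {x : Std K e i}, e l • C.mkQ x ≠ 0 → l = i := by
  have := finiteDimensional_std K e i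
  have : Module.Finite A (Std K e i) := Module.Finite.of_restrictScalars_finite K A _
  have : Nontrivial (Std K e i) := nontrivial_of_mult_ne_zero (K := K) (e := e) (k := i) (by
    rw [mult_std hA]; simp)
  obtain ⟨C, hC, -⟩ := (eq_top_or_exists_le_coatom (⊥ : Submodule A (Std K e i))).resolve_left
    bot_ne_top
  have hs : IsSimpleModule A (Std K e i ⧸ C) := isSimpleModule_iff_isCoatom.2 hC
  refine ⟨C, hs, fun {l x} hx => eq_of_smul_ne_zero K he hx
    (y := C.mkQ ((stdKer K e i).mkQ (projGen e i))) fun h => hC.1 ?_⟩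
  rw [← map_smul, smul_stdGen he, Submodule.mkQ_apply, Submodule.Quotient.mk_eq_zero] at h
  refine Submodule.eq_top_iff'.2 fun z => ?_
  obtain ⟨a, rfl⟩ := exists_smul_eq_stdGen he z
  exact C.smul_mem a h

/-- If `M` is generated by `e l • M`, `l ∈ U`, and maps onto `Δ(i)`, then `i ∈ U`. -/
theorem mem_of_surjective_std (he : IsBasicSystem e) (hA : IsOneQuasiHereditary K e) {i : ι}
    {U : Set ι} (hM : trace e U M = ⊤) (f : M →ₗ[A] Std K e i) (hf : Function.Surjective f) :
    i ∈ U := by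
  obtain ⟨C, hC, h⟩ := exists_simple_quotient_std he hA i
  have := IsSimpleModule.nontrivial A (Std K e i ⧸ C)
  by_contra hi
  have htop : trace e U (Std K e i ⧸ C) = ⊤ := by
    have hs : Function.Surjective (C.mkQ.comp f) := C.mkQ_surjective.comp hf
    rw [← trace_map_of_surjective U hs, hM, Submodule.map_top, LinearMap.range_eq_top.2 hs]
  have hbot : trace e U (Std K e i ⧸ C) = ⊥ := by
    refine le_bot_iff.1 (trace_le_iff.2 fun l hl y => ?_)
    obtain ⟨x, rfl⟩ := C.mkQ_surjective y
    by_contra hx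
    exact hi (h (fun h0 => hx ((Submodule.mem_bot A).2 h0)) ▸ hl)
  exact bot_ne_top (hbot.symm.trans htop)

/-- Δ(i) is generated by its vertex space at i, so N is N' plus the submodule generated by `e i •
N`. -/
theorem le_trace_of_subquot_equiv (he : IsBasicSystem e) {i : ι} {U : Set ι} (hi : i ∈ U)
    {N N' : Submodule A M} (h : N' ≤ trace e U M) (g : Subquot N N' ≃ₗ[A] Std K e i) :
    N ≤ trace e U M := by
  intro x hx
  obtain ⟨y, hy⟩ := Submodule.mkQ_surjective (N'.submoduleOf N)
    (g.symm ((stdKer K e i).mkQ (projGen e i)))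
  obtain ⟨a, ha⟩ := exists_smul_eq_stdGen he (g (Submodule.mkQ _ ⟨x, hx⟩))
  have h1 : Submodule.mkQ (N'.submoduleOf N) (⟨x, hx⟩ - a • e i • y) = 0 := by
    apply g.injective
    rw [map_sub, map_smul, map_smul, hy, map_sub, ha, map_smul, map_smul, g.apply_symm_apply,
      smul_stdGen he, sub_self, map_zero]
  rw [Submodule.mkQ_apply, Submodule.Quotient.mk_eq_zero] at h1
  change x - a • e i • (y : M) ∈ N' at h1
  have h2 := (trace e U M).add_mem (h h1)
    ((trace e U M).smul_mem a (smul_mem_trace hi (y : M)))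
  simpa using h2

/-- The defining condition involves all l ≰ j, but l > j suffices. In a Δ-good filtration of P(j)
the top subquotient is Δ(j), because P(j) is generated at j; the others are Δ(i) with i > j, so the
term below the top lies in the trace of {l | j < l}. That term and the kernel have equal
multiplicities. -/
theorem stdKer_eq_trace (he : IsBasicSystem e) (hA : IsOneQuasiHereditary K e) (j : ι) :
    stdKer K e j = trace e (Set.Ioi j) (Proj e j) := by
  have := finiteDimensional_proj K e j
  have hle : trace e (Set.Ioi j) (Proj e j) ≤ stdKer K e j := trace_le_iff.2 fun l hl x =>
    (mult_quotient_eq_zero_iff (K := K) _ l).1 ((stdKer_isLeast K e j).1 l (not_le_of_gt hl)) x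
  refine le_antisymm ?_ hle
  obtain ⟨⟨n, F, hF⟩, hgood, -⟩ := hA.proj_std_self j
  have hcard := card_subquot_eq he hA hgood
  obtain ⟨h0, h1, hsub⟩ := hgood
  change F 0 = ⊥ at h0
  change F (Fin.last n) = ⊤ at h1
  change ∀ t : Fin n, ∃ i, Nonempty (Subquot (F t.succ) (F t.castSucc) ≃ₗ[A] Std K e i) at hsub
  change ∀ i, Nat.card {t : Fin n // Nonempty (Subquot (F t.succ) (F t.castSucc) ≃ₗ[A]
    Std K e i)} = _ at hcard
  cases n with
  | zero =>
    have : (⊥ : Submodule A (Proj e j)) = ⊤ := h0.symm.trans h1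
    exact (projGen_ne_zero (he.primitive j) ((Submodule.mem_bot A).1
      (this ▸ Submodule.mem_top))).elim
  | succ n =>
    have hsurj : ∀ {i : ι}, (Subquot (F (Fin.last n).succ) (F (Fin.last n).castSucc) ≃ₗ[A]
        Std K e i) → i = j := fun {i} g => by
      have hF1 : F (Fin.last n).succ = ⊤ := h1
      refine mem_of_surjective_std he hA (U := {j}) (M := Proj e j)
        (trace_proj_self (he.complete.idem j) rfl)
        (g.toLinearMap.comp ((Submodule.mkQ _).comp
          (LinearMap.codRestrict (F (Fin.last n).succ) LinearMap.id fun x => hF1 ▸ trivial))) ?_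
      refine g.surjective.comp ((Submodule.mkQ_surjective _).comp ?_)
      exact fun x => ⟨x.1, rfl⟩
    have hlast : Nonempty (Subquot (F (Fin.last n).succ) (F (Fin.last n).castSucc) ≃ₗ[A]
        Std K e j) := by
      obtain ⟨i, ⟨g⟩⟩ := hsub (Fin.last n)
      obtain rfl := (hsurj g).symm
      exact ⟨g⟩
    have hlab : ∀ t : Fin n, ∃ i, j < i ∧
        Nonempty (Subquot (F t.castSucc.succ) (F t.castSucc.castSucc) ≃ₗ[A] Std K e i) := by
      intro t
      obtain ⟨i, hi⟩ := hsub t.castSucc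
      refine ⟨i, lt_of_le_of_ne ?_ ?_, hi⟩
      · by_contra hji
        have := hcard i
        rw [if_neg hji, Nat.card_eq_zero] at this
        rcases this with h | h
        · exact h.elim ⟨_, hi⟩
        · exact h.not_finite inferInstance
      · rintro rfl
        have := hcard j
        rw [if_pos le_rfl, Nat.card_eq_one_iff_unique] at this
        have := congrArg Subtype.val (@Subsingleton.elim _ this.1
          (⟨_, hi⟩ : {t : Fin (n + 1) // Nonempty (Subquot (F t.succ) (F t.castSucc) ≃ₗ[A]
            Std K e j)}) ⟨_, hlast⟩)
        exact (Fin.castSucc_lt_last t).ne this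
    have htr : ∀ t : Fin (n + 1), F t.castSucc ≤ trace e (Set.Ioi j) (Proj e j) := by
      intro t
      induction t using Fin.induction with
      | zero => rw [Fin.castSucc_zero, h0]; exact bot_le
      | succ t ih =>
        obtain ⟨i, hi, ⟨g⟩⟩ := hlab t
        exact le_trace_of_subquot_equiv (K := K) he hi ih g
    refine le_trans (le_of_eq ?_) (htr (Fin.last n))
    refine (eq_of_le_of_mult_le (K := K) he.complete ((htr (Fin.last n)).trans hle)
      fun k => ?_).symm
    have e1 : mult K e (Proj e j) k = mult K e (stdKer K e j) k + mult K e (Std K e j) k :=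
      mult_eq_add_quotient (he.complete.idem k) (stdKer K e j)
    have e2 := mult_eq_add_subquot (K := K) (he.complete.idem k)
      (le_of_lt (hF (Fin.last n)) : F (Fin.last n).castSucc ≤ F (Fin.last n).succ)
    have hF1 : F (Fin.last n).succ = ⊤ := h1
    rw [mult_eq_of_equiv hlast.some, hF1, mult_top] at e2
    omega

end StandardStep

section StandardStep

open scoped Classical

variable {K A ι : Type*} [Field K] [Ring A] [Algebra K A] [FiniteDimensional K A]
  [Fintype ι] [PartialOrder ι] [BoundedOrder ι] {e : ι → A}

theorem trace_le_sup_erase {M : Type*} [AddCommGroup M] [Module A M] (U : Finset ι) (i : ι) :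
    trace e U M ≤ trace e {i} M ⊔ trace e (U.erase i : Finset ι) M := by
  refine trace_le_iff.2 fun l hl x => ?_
  by_cases h : l = i
  · subst h
    exact Submodule.mem_sup_left (smul_mem_trace (Set.mem_singleton l) x)
  · exact Submodule.mem_sup_right
      (smul_mem_trace (Finset.mem_coe.2 (Finset.mem_erase.2 ⟨h, hl⟩)) x)

theorem trace_erase_le {M : Type*} [AddCommGroup M] [Module A M] (U : Finset ι) (i : ι) :
    trace e (U.erase i : Finset ι) M ≤ trace e U M :=
  trace_mono (Finset.coe_subset.2 (Finset.erase_subset _ _))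

/-- The copy of P(i) covers the subquotient, and the kernel of P(i) ↠ Δ(i), generated at vertices
above i, lands in the trace of U \ {i}. -/
theorem exists_std_to_subquot (he : IsBasicSystem e) (hA : IsOneQuasiHereditary K e) {i j : ι}
    {U : Finset ι} (hU : IsUpper j U) (hi : i ∈ U) :
    ∃ f : Std K e i →ₗ[A] Subquot (trace e U (Proj e j)) (trace e (U.erase i : Finset ι) (Proj e j)),
      Function.Surjective f := by
  obtain ⟨f, hf⟩ := exists_proj_to_proj he hA (hU.2 i hi)
  have hr := range_eq_trace he hA (hU.2 i hi) hf
  have hmem : ∀ x, f x ∈ trace e U (Proj e j) := fun x =>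
    trace_mono (Set.singleton_subset_iff.2 hi) (hr ▸ ⟨x, rfl⟩ : f x ∈ trace e {i} (Proj e j))
  refine ⟨(stdKer K e i).liftQ ((Submodule.mkQ _).comp (f.codRestrict _ hmem)) ?_, ?_⟩
  · rw [stdKer_eq_trace he hA]
    intro x hx
    rw [LinearMap.mem_ker, LinearMap.comp_apply, Submodule.mkQ_apply,
      Submodule.Quotient.mk_eq_zero]
    exact trace_mono (hU.Ioi_subset_erase hi) (trace_map_le _ f ⟨x, hx, rfl⟩)
  · intro z
    obtain ⟨⟨y, hy⟩, rfl⟩ := Submodule.mkQ_surjective _ z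
    obtain ⟨u, hu, v, hv, rfl⟩ := Submodule.mem_sup.1 (trace_le_sup_erase U i hy)
    obtain ⟨x, rfl⟩ : u ∈ LinearMap.range f := hr ▸ hu
    refine ⟨Submodule.Quotient.mk x, ?_⟩
    refine (Submodule.Quotient.eq _).2 ?_
    change f x - (f x + v) ∈ trace e (U.erase i : Finset ι) (Proj e j)
    simpa using hv

/-- The preceding surjections bound each step by Δ(i), and the known multiplicities of P(j) make the
counting principle applicable. -/
theorem mult_trace (he : IsBasicSystem e) (hA : IsOneQuasiHereditary K e) {j : ι}
    {U : Finset ι} (hU : IsUpper j U) (k : ι) :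
    mult K e (trace e U (Proj e j)) k = ∑ l ∈ U, if k ≤ l then 1 else 0 := by
  have := finiteDimensional_proj K e j
  refine eq_sum_of_forall_le (j := j)
    (f := fun U : Finset ι => mult K e (trace e U (Proj e j)) k) ?_ ?_ ?_ hU
  · rw [Finset.coe_empty, trace_empty]
    exact mult_eq_zero_of_subsingleton k
  · intro U hU i hi
    obtain ⟨f, hf⟩ := exists_std_to_subquot he hA hU hi.1
    have := finiteDimensional_std K e i
    have h := mult_le_of_surjective (K := K) (he.complete.idem k) hf
    rw [mult_std hA] at h
    rw [mult_eq_add_subquot (he.complete.idem k) (trace_erase_le U i)]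
    omega
  · rw [trace_proj_self (he.complete.idem j) (by simp), mult_top, mult_proj he hA,
      Finset.card_filter, Finset.sum_filter]
    refine Finset.sum_le_sum fun l _ => ?_
    split_ifs <;> simp_all

theorem nonempty_trace_subquot_equiv (he : IsBasicSystem e) (hA : IsOneQuasiHereditary K e)
    {i j : ι} {U : Finset ι} (hU : IsUpper j U) (hi : Minimal (· ∈ U) i) :
    Nonempty (Subquot (trace e U (Proj e j)) (trace e (U.erase i : Finset ι) (Proj e j)) ≃ₗ[A]
      Std K e i) := by
  have := finiteDimensional_proj K e j
  have := finiteDimensional_std K e i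
  obtain ⟨f, hf⟩ := exists_std_to_subquot he hA hU hi.1
  refine ⟨(LinearEquiv.ofBijective f ⟨injective_of_mult_le (K := K) he.complete hf fun k => ?_,
    hf⟩).symm⟩
  have h := mult_eq_add_subquot (K := K) (he.complete.idem k) (trace_erase_le (e := e)
    (M := Proj e j) U i)
  rw [mult_trace he hA hU, mult_trace he hA (hU.erase hi), ← Finset.add_sum_erase _ _ hi.1] at h
  rw [mult_std hA]
  omega

/-- This determines all possible next terms of a Δ-good filtration read from the top downwards. -/
theorem trace_lt_iff (he : IsBasicSystem e) (hA : IsOneQuasiHereditary K e)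
    {i j : ι} {U : Finset ι} (hU : IsUpper j U) (N : Submodule A (Proj e j)) :
    (N < trace e U (Proj e j) ∧ Nonempty (Subquot (trace e U (Proj e j)) N ≃ₗ[A] Std K e i)) ↔
      Minimal (· ∈ U) i ∧ N = trace e (U.erase i : Finset ι) (Proj e j) := by
  have := finiteDimensional_proj K e j
  constructor
  · rintro ⟨hlt, ⟨g⟩⟩
    have hmin : Minimal (· ∈ U) i := by
      set V : Set ι := {l | Minimal (· ∈ U) l} with hV
      -- The minimal vertices of U generate the trace, since P(l) contains `e k • P(j)` for k ≥ l. A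
      -- quotient Δ(i) must then have i among them.
      have hUV : trace e U (Proj e j) ≤ trace e V (Proj e j) := by
        refine trace_le_iff.2 fun k hk x => ?_
        obtain ⟨l, hl, hmin⟩ := exists_minimal_le hk
        exact trace_mono (Set.singleton_subset_iff.2 (show l ∈ V from hmin))
          (smul_mem_trace_of_le he hA (hU.2 l hmin.1) hl x)
      refine mem_of_surjective_std he hA (U := V) (M := trace e U (Proj e j)) ?_
        (g.toLinearMap.comp (Submodule.mkQ _)) (g.surjective.comp (Submodule.mkQ_surjective _))
      refine Submodule.map_injective_of_injective (Submodule.subtype_injective _) ?_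
      rw [Submodule.map_subtype_top]
      refine le_antisymm (Submodule.map_subtype_le _ _) (hUV.trans (trace_le_iff.2 ?_))
      intro l hl x
      refine ⟨e l • ⟨e l • x, smul_mem_trace (show l ∈ (U : Set ι) from hl.1) x⟩,
        smul_mem_trace hl _, ?_⟩
      change e l • e l • x = e l • x
      rw [← mul_smul, (he.complete.idem l).eq]
    -- By minimality of i no other l in U is ≤ i, so S(l) is not a factor of Δ(i) and N contains `e
    -- l • P(j)`. Multiplicities then give equality.
    refine ⟨hmin, (eq_of_le_of_mult_le (K := K) he.complete (trace_le_iff.2 fun l hl x => ?_)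
      fun k => ?_).symm⟩
    · have hl' : l ≠ i ∧ l ∈ U := Finset.mem_erase.1 (Finset.mem_coe.1 hl)
      have hli : ¬ l ≤ i := fun h => hl'.1 (le_antisymm h (hmin.2 hl'.2 h))
      have := finiteDimensional_submodule (K := K) (trace e U (Proj e j))
      have h0 : mult K e (Subquot (trace e U (Proj e j)) N) l = 0 := by
        rw [mult_eq_of_equiv g, mult_std hA, if_neg hli]
      have := (mult_quotient_eq_zero_iff (K := K) _ l).1 h0
        ⟨e l • x, smul_mem_trace (show l ∈ (U : Set ι) from hl'.2) x⟩
      change e l • e l • x ∈ N at this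
      rwa [← mul_smul, (he.complete.idem l).eq] at this
    · have h1 := mult_eq_add_subquot (K := K) (he.complete.idem k) hlt.le
      have h2 := mult_eq_add_subquot (K := K) (he.complete.idem k)
        (trace_erase_le (e := e) (M := Proj e j) U i)
      rw [mult_eq_of_equiv g] at h1
      rw [mult_eq_of_equiv (nonempty_trace_subquot_equiv he hA hU hmin).some] at h2
      omega
  · rintro ⟨hmin, rfl⟩
    have g := nonempty_trace_subquot_equiv he hA hU hmin
    refine ⟨lt_of_le_of_ne (trace_erase_le U i) fun h => ?_, g⟩
    have h1 := mult_trace he hA hU i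
    rw [← h, mult_trace he hA (hU.erase hmin), ← Finset.add_sum_erase _ _ hmin.1] at h1
    simp at h1

end StandardStep

/-! ### Costandard modules bounded through the pairing with projectives -/

section CostandardStep

open scoped Classical

variable {K A ι : Type*} [Field K] [Ring A] [Algebra K A] [FiniteDimensional K A]
  [Fintype ι] [PartialOrder ι] [BoundedOrder ι] {e : ι → A}

theorem pair_eq_zero_of_mem_trace {i k : ι} {V : Set ι}
    {N : Submodule A (Inj K e i)} (hN : ∀ l ∈ V, ∀ φ ∈ N, e l • φ = 0) {φ : Inj K e i}
    (hφ : φ ∈ N) {w : Proj e k} (hw : w ∈ trace e V (Proj e k)) : φ.pair (w : A) = 0 := by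
  suffices h : trace e V (Proj e k) ≤
      -- Quantifying over all left multiples makes the annihilator of φ a submodule.
      { carrier := {w | ∀ a : A, φ.pair (a * (w : A)) = 0}
        zero_mem' := fun a => by simp
        add_mem' := fun hx hy a => by
          rw [Submodule.coe_add, mul_add, map_add, hx a, hy a, add_zero]
        smul_mem' := fun b x hx a => by
          rw [Submodule.coe_smul, smul_eq_mul, ← mul_assoc]
          exact hx (a * b) } by
    simpa using h hw 1
  refine trace_le_iff.2 fun l hl x a => ?_
  rw [Submodule.coe_smul, smul_eq_mul, ← mul_assoc, ← Inj.pair_smul, ← Inj.pair_smul,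
    hN l hl _ (N.smul_mem _ hφ), Inj.pair_zero]

theorem isUpper_inf (k i : ι) : IsUpper k (Finset.univ.filter fun l => k ≤ l ∧ i ≤ l) := by
  refine ⟨fun a b hab ha => ?_, fun l hl => (Finset.mem_filter.1 hl).2.1⟩
  simp only [Finset.coe_filter, Finset.mem_univ, true_and, Set.mem_ofPred_eq] at ha ⊢
  exact ⟨ha.1.trans hab, ha.2.trans hab⟩

/-- `e i • P(k)` has dimension #{l | k ≤ l, i ≤ l}, and the trace of this upper set already has that
multiplicity at i. Hence `e i A e k` factors through common upper bounds of i and k. -/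
theorem smul_mem_trace_inf (he : IsBasicSystem e) (hA : IsOneQuasiHereditary K e) (k i : ι)
    (x : Proj e k) :
    e i • x ∈ trace e (Finset.univ.filter fun l => k ≤ l ∧ i ≤ l : Finset ι) (Proj e k) := by
  have := finiteDimensional_proj K e k
  refine smul_mem_of_mult_le (K := K) (he.complete.idem i) ?_ x
  rw [mult_trace he hA (isUpper_inf k i), mult_proj he hA, ← Finset.card_filter,
    Finset.filter_filter]
  exact Finset.card_le_card fun l => by simp

/-- A submodule of `I(i)` without composition factors `S(l)`, `l > i`, is contained in `∇(i)`. -/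
theorem le_costd (he : IsBasicSystem e) (hA : IsOneQuasiHereditary K e) {i : ι}
    {N : Submodule A (Inj K e i)} (hN : ∀ l, i < l → ∀ φ ∈ N, e l • φ = 0) :
    N ≤ Costd K e i := by
  have := finiteDimensional_inj K e i
  refine (costd_isGreatest K e i).2 fun k hk => (mult_submodule_eq_zero_iff _ k).2 fun φ hφ => ?_
  refine Inj.eq_zero_of_pair fun a => ?_
  -- For k ≰ i every common upper bound of i and k is strictly above i, so φ vanishes on `e i A e
  -- k`.
  rw [Inj.pair_smul, ← Inj.pair_mul_left (he.complete.idem i)]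
  refine pair_eq_zero_of_mem_trace (fun l hl => hN l ?_) hφ
    (smul_mem_trace_inf he hA k i (a • projGen e k))
  have hl' : k ≤ l ∧ i ≤ l := by simpa using hl
  refine lt_of_le_of_ne hl'.2 ?_
  rintro rfl
  exact hk hl'.1

theorem smul_eq_zero_of_mem_costd {i l : ι} (h : ¬ l ≤ i) {φ : Inj K e i}
    (hφ : φ ∈ Costd K e i) : e l • φ = 0 :=
  have := finiteDimensional_inj K e i
  (mult_submodule_eq_zero_iff _ l).1 ((costd_isGreatest K e i).1 l h) φ hφ

/-- Forms in ∇(i) vanish on the part W of P(k) generated at vertices above i. So `e k • ∇(i)` embeds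
into the dual of `e i • (P(k)/W)`, which is one-dimensional for k ≤ i. -/
theorem mult_costd_le (he : IsBasicSystem e) (hA : IsOneQuasiHereditary K e) (i k : ι) :
    mult K e (Costd K e i) k ≤ if k ≤ i then 1 else 0 := by
  have := finiteDimensional_inj K e i
  have := finiteDimensional_proj K e k
  split_ifs with hk
  · have hup : IsUpper k (Finset.univ.filter fun l => i < l) := by
      refine ⟨fun a b hab ha => ?_, fun l hl => hk.trans (Finset.mem_filter.1 hl).2.le⟩
      simp only [Finset.coe_filter, Finset.mem_univ, true_and, Set.mem_ofPred_eq] at ha ⊢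
      exact ha.trans_le hab
    set W := trace e (Finset.univ.filter fun l => i < l : Finset ι) (Proj e k) with hW
    have h1 : mult K e (Proj e k ⧸ W) i = 1 := by
      have h := mult_eq_add_quotient (K := K) (he.complete.idem i) W
      rw [mult_trace he hA hup, mult_proj_of_le he hA hk, ← Finset.card_filter,
        Finset.filter_filter] at h
      have h2 : (Finset.univ.filter fun l => i ≤ l) =
          insert i (Finset.univ.filter fun l => i < l ∧ i ≤ l) := by
        ext l
        simp only [Finset.mem_filter, Finset.mem_univ, true_and, Finset.mem_insert]
        constructor
        · intro h
          rcases h.eq_or_lt with rfl | h'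
          · exact Or.inl rfl
          · exact Or.inr ⟨h', h⟩
        · rintro (rfl | h)
          · exact le_rfl
          · exact h.2
      rw [h2, Finset.card_insert_of_notMem (by simp)] at h
      omega
    obtain ⟨⟨_, z, rfl⟩, -, hz⟩ := finrank_eq_one_iff'.1 h1
    obtain ⟨z, rfl⟩ := Submodule.mkQ_surjective _ z
    have hz' : ∀ a : A, ∃ c : K, ∃ w ∈ W, e i * a * e k = c • (e i * (z : A)) + w := by
      intro a
      obtain ⟨c, hc⟩ := hz ⟨_, W.mkQ (a • projGen e k), rfl⟩
      have hc' : c • e i • W.mkQ z = e i • W.mkQ (a • projGen e k) := congrArg Subtype.val hc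
      refine ⟨c, e i • a • projGen e k - c • e i • z, ?_, ?_⟩
      · rw [← Submodule.Quotient.mk_eq_zero]
        change e i • W.mkQ (a • projGen e k) - c • e i • W.mkQ z = 0
        exact sub_eq_zero.2 hc'.symm
      · change _ = _ + (e i * (a * e k) - c • (e i * (z : A)))
        rw [mul_assoc]; abel
    let ev : vertexSpace K e (Costd K e i) k →ₗ[K] K :=
      { toFun := fun φ => (φ.1.1 : Inj K e i).pair (e i * (z : A))
        map_add' := fun φ ψ => rfl
        map_smul' := fun c φ => rfl }
    have hinj : Function.Injective ev := by
      refine (injective_iff_map_eq_zero ev).2 fun φ hφ => ?_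
      have hkφ : e k • (φ.1.1 : Inj K e i) = φ.1.1 :=
        congrArg Subtype.val ((mem_vertexSpace_iff (he.complete.idem k) _).1 φ.2)
      refine Subtype.ext (Subtype.ext (Inj.eq_zero_of_pair fun a => ?_))
      obtain ⟨c, w, hw, hcw⟩ := hz' a
      rw [← hkφ, Inj.pair_smul, ← Inj.pair_mul_left (he.complete.idem i), ← mul_assoc, hcw,
        map_add, map_smul, show φ.1.1.pair (e i * (z : A)) = 0 from hφ, smul_zero, zero_add]
      exact pair_eq_zero_of_mem_trace (fun l hl ψ hψ => smul_eq_zero_of_mem_costd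
        (not_le_of_gt (by simpa using hl)) hψ) φ.1.2 hw
    exact (LinearMap.finrank_le_finrank_of_injective hinj).trans_eq (Module.finrank_self K)
  · exact ((costd_isGreatest K e i).1 k hk).le

end CostandardStep

/-! ### Removing a minimal vertex from a reject adds a costandard module -/

section CostandardStep

open scoped Classical

variable {K A ι : Type*} [Field K] [Ring A] [Algebra K A] [FiniteDimensional K A]
  [Fintype ι] [PartialOrder ι] [BoundedOrder ι] {e : ι → A}
variable {M M' : Type*} [AddCommGroup M] [Module K M] [Module A M] [IsScalarTower K A M]
  [AddCommGroup M'] [Module K M'] [Module A M'] [IsScalarTower K A M']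

theorem mult_le_of_injective [FiniteDimensional K M'] {k : ι} (hk : IsIdempotentElem (e k))
    {f : M →ₗ[A] M'} (hf : Function.Injective f) : mult K e M k ≤ mult K e M' k := by
  rw [← mult_range_of_injective hf]
  exact mult_submodule_le hk _

theorem ker_le_reject_of_surjective [FiniteDimensional K M] {k : ι} (hk : IsIdempotentElem (e k))
    {f : M →ₗ[A] M'} (hf : Function.Surjective f) (h : mult K e M k = mult K e M' k) :
    LinearMap.ker f ≤ reject e {k} M := by
  have h1 := mult_eq_ker_add (K := K) hk hf
  refine le_reject_iff.2 ?_
  rintro _ rfl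
  exact (mult_submodule_eq_zero_iff (K := K) _ _).1 (by omega)

/-- Equal multiplicities at i keep S(i) out of the kernel; conversely the reject maps into the
reject of I(i), which is zero. -/
theorem ker_eq_reject [FiniteDimensional K M] {i : ι} (hi : IsIdempotentElem (e i))
    {f : M →ₗ[A] Inj K e i} (hf : Function.Surjective f)
    (h : mult K e M i = mult K e (Inj K e i) i) : LinearMap.ker f = reject e {i} M := by
  refine le_antisymm (ker_le_reject_of_surjective hi hf h) fun x hx => ?_
  rw [LinearMap.mem_ker, ← Submodule.mem_bot A, ← reject_inj_self (K := K) hi]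
  intro l hl a
  rw [← map_smul, ← map_smul, hx l hl, map_zero]

theorem ker_proj_bot_to_inj (he : IsBasicSystem e) (hA : IsOneQuasiHereditary K e) {i : ι}
    {f : Proj e (⊥ : ι) →ₗ[A] Inj K e i} (hf : Function.Surjective f) :
    LinearMap.ker f = reject e {i} (Proj e (⊥ : ι)) :=
  have := finiteDimensional_proj K e (⊥ : ι)
  ker_eq_reject (he.complete.idem i) hf
    ((mult_proj_of_le he hA bot_le).trans (mult_inj_of_le he hA le_rfl).symm)

theorem ker_proj_bot_to_inj_le (he : IsBasicSystem e) (hA : IsOneQuasiHereditary K e) {i j : ι}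
    (h : j ≤ i) {f : Proj e (⊥ : ι) →ₗ[A] Inj K e j} (hf : Function.Surjective f) :
    LinearMap.ker f ≤ reject e {i} (Proj e (⊥ : ι)) :=
  have := finiteDimensional_proj K e (⊥ : ι)
  ker_le_reject_of_surjective (he.complete.idem i) hf
    ((mult_proj_of_le he hA bot_le).trans (mult_inj_of_le he hA h).symm)

theorem nonempty_quotient_equiv_inj_iff (he : IsBasicSystem e) (hA : IsOneQuasiHereditary K e)
    (i : ι) (N : Submodule A (Proj e (⊥ : ι))) :
    Nonempty ((Proj e (⊥ : ι) ⧸ N) ≃ₗ[A] Inj K e i) ↔ N = reject e {i} (Proj e (⊥ : ι)) := by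
  constructor
  · rintro ⟨g⟩
    rw [← ker_proj_bot_to_inj he hA (f := g.toLinearMap.comp N.mkQ)
      (g.surjective.comp N.mkQ_surjective), LinearEquiv.ker_comp, Submodule.ker_mkQ]
  · rintro rfl
    obtain ⟨f, hf⟩ := exists_proj_bot_to_inj he hA i
    rw [← ker_proj_bot_to_inj he hA hf]
    exact ⟨f.quotKerEquivOfSurjective hf⟩

theorem reject_proj_bot_anti (he : IsBasicSystem e) (hA : IsOneQuasiHereditary K e) {i j : ι}
    (h : j ≤ i) : reject e {j} (Proj e (⊥ : ι)) ≤ reject e {i} (Proj e (⊥ : ι)) := by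
  obtain ⟨f, hf⟩ := exists_proj_bot_to_inj he hA j
  rw [← ker_proj_bot_to_inj he hA hf]
  exact ker_proj_bot_to_inj_le he hA h hf

theorem map_reject_proj_bot (he : IsBasicSystem e) (hA : IsOneQuasiHereditary K e) {j : ι}
    {U : Set ι} (hU : ∀ l ∈ U, j ≤ l) {f : Proj e (⊥ : ι) →ₗ[A] Inj K e j}
    (hf : Function.Surjective f) :
    (reject e U (Proj e (⊥ : ι))).map f = reject e U (Inj K e j) :=
  reject_map_of_surjective hf (fun _ hx l hl => ker_proj_bot_to_inj_le he hA (hU l hl) hf hx l rfl)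
    fun l _ => he.complete.idem l

theorem exists_inj_to_inj (he : IsBasicSystem e) (hA : IsOneQuasiHereditary K e) {i j : ι}
    (h : j ≤ i) : ∃ f : Inj K e j →ₗ[A] Inj K e i, Function.Surjective f := by
  obtain ⟨f, hf⟩ := exists_proj_bot_to_inj he hA j
  obtain ⟨g, hg⟩ := exists_proj_bot_to_inj he hA i
  have hker : LinearMap.ker f ≤ LinearMap.ker g := by
    rw [ker_proj_bot_to_inj he hA hg]
    exact ker_proj_bot_to_inj_le he hA h hf
  refine ⟨((LinearMap.ker f).liftQ g hker).comp
    (f.quotKerEquivOfSurjective hf).symm.toLinearMap, ?_⟩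
  rw [LinearMap.coe_comp]
  refine Function.Surjective.comp (fun y => ?_)
    (LinearEquiv.surjective (f.quotKerEquivOfSurjective hf).symm)
  obtain ⟨x, rfl⟩ := hg y
  exact ⟨Submodule.Quotient.mk x, rfl⟩

theorem ker_inj_to_inj (he : IsBasicSystem e) (hA : IsOneQuasiHereditary K e) {i j : ι}
    (h : j ≤ i) {f : Inj K e j →ₗ[A] Inj K e i} (hf : Function.Surjective f) :
    LinearMap.ker f = reject e {i} (Inj K e j) :=
  have := finiteDimensional_inj K e j
  ker_eq_reject (he.complete.idem i) hf
    ((mult_inj_of_le he hA h).trans (mult_inj_of_le he hA le_rfl).symm)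

theorem reject_inj_anti (he : IsBasicSystem e) (hA : IsOneQuasiHereditary K e) {j l k : ι}
    (hjl : j ≤ l) (h : l ≤ k) : reject e {l} (Inj K e j) ≤ reject e {k} (Inj K e j) := by
  have := finiteDimensional_inj K e j
  obtain ⟨f, hf⟩ := exists_inj_to_inj he hA hjl
  rw [← ker_inj_to_inj he hA hjl hf]
  exact ker_le_reject_of_surjective (he.complete.idem k) hf
    ((mult_inj_of_le he hA (hjl.trans h)).trans (mult_inj_of_le he hA h).symm)

theorem reject_le_erase {M : Type*} [AddCommGroup M] [Module A M] (U : Finset ι) (i : ι) :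
    reject e U M ≤ reject e (U.erase i : Finset ι) M :=
  reject_anti (Finset.coe_subset.2 (Finset.erase_subset _ _))

theorem mem_reject_of_erase {M : Type*} [AddCommGroup M] [Module A M] {U : Finset ι} {i : ι}
    {x : M} (h : x ∈ reject e (U.erase i : Finset ι) M) (hi : x ∈ reject e {i} M) :
    x ∈ reject e U M := by
  intro l hl
  by_cases hli : l = i
  · subst hli
    exact hi l rfl
  · exact h l (Finset.mem_coe.2 (Finset.mem_erase.2 ⟨hli, hl⟩))

/-- The covering I(j) ↠ I(i) has kernel `reject e {i}`, so on the reject of U \ {i} its kernel is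
the reject of U. The image has no factor S(l) with l > i, hence lies in ∇(i) by `le_costd`. -/
theorem exists_subquot_to_costd (he : IsBasicSystem e) (hA : IsOneQuasiHereditary K e) {i j : ι}
    {U : Finset ι} (hU : IsUpper j U) (hi : i ∈ U) :
    ∃ f : Subquot (reject e (U.erase i : Finset ι) (Inj K e j)) (reject e U (Inj K e j)) →ₗ[A]
      Costd K e i, Function.Injective f := by
  obtain ⟨f, hf⟩ := exists_inj_to_inj he hA (hU.2 i hi)
  have hk := ker_inj_to_inj he hA (hU.2 i hi) hf
  have hle : (reject e (U.erase i : Finset ι) (Inj K e j)).map f ≤ Costd K e i := by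
    refine le_costd he hA ?_
    rintro l hl _ ⟨x, hx, rfl⟩
    rw [← map_smul, smul_eq_zero_of_mem_reject hx (hU.Ioi_subset_erase hi hl), map_zero]
  let g : reject e (U.erase i : Finset ι) (Inj K e j) →ₗ[A] Costd K e i :=
    (f.comp (Submodule.subtype _)).codRestrict _ fun x => hle ⟨x.1, x.2, rfl⟩
  have hg : LinearMap.ker g = (reject e U (Inj K e j)).submoduleOf
      (reject e (U.erase i : Finset ι) (Inj K e j)) := by
    ext x
    have h1 : x ∈ LinearMap.ker g ↔ (x : Inj K e j) ∈ LinearMap.ker f := by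
      rw [LinearMap.mem_ker, LinearMap.mem_ker, Subtype.ext_iff]
      rfl
    rw [h1, hk]
    exact ⟨fun h => mem_reject_of_erase x.2 h,
      fun h => reject_anti (Set.singleton_subset_iff.2 hi) h⟩
  exact ⟨Submodule.liftQ _ g hg.ge, LinearMap.ker_eq_bot.1 (Submodule.ker_liftQ_eq_bot _ _ _ hg.le)⟩

theorem reject_inj_Ici (he : IsBasicSystem e) (j : ι) :
    reject e (Finset.univ.filter (j ≤ ·) : Finset ι) (Inj K e j) = ⊥ := by
  rw [← le_bot_iff, ← reject_inj_self (K := K) (he.complete.idem j)]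
  exact reject_anti (by simp)

theorem mult_quotient_reject (he : IsBasicSystem e) (hA : IsOneQuasiHereditary K e) {j : ι}
    {U : Finset ι} (hU : IsUpper j U) (k : ι) :
    mult K e (Inj K e j ⧸ reject e U (Inj K e j)) k = ∑ l ∈ U, if k ≤ l then 1 else 0 := by
  have := finiteDimensional_inj K e j
  refine eq_sum_of_forall_le (j := j)
    (f := fun U : Finset ι => mult K e (Inj K e j ⧸ reject e U (Inj K e j)) k) ?_ ?_ ?_ hU
  · rw [Finset.coe_empty, reject_empty]
    exact mult_eq_zero_of_subsingleton k
  · intro U hU i hi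
    obtain ⟨f, hf⟩ := exists_subquot_to_costd he hA hU hi.1
    have := finiteDimensional_inj K e i
    have := finiteDimensional_submodule (K := K) (Costd K e i)
    have h := (mult_le_of_injective (K := K) (he.complete.idem k) hf).trans (mult_costd_le he hA i k)
    have h1 := mult_eq_add_quotient (K := K) (he.complete.idem k) (reject e U (Inj K e j))
    have h2 := mult_eq_add_quotient (K := K) (he.complete.idem k)
      (reject e (U.erase i : Finset ι) (Inj K e j))
    have h3 := mult_eq_add_subquot (K := K) (he.complete.idem k)
      (reject_le_erase (e := e) (M := Inj K e j) U i)
    omega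
  · have h1 := mult_eq_add_quotient (K := K) (he.complete.idem k) (⊥ : Submodule A (Inj K e j))
    rw [mult_eq_zero_of_subsingleton (M := (⊥ : Submodule A (Inj K e j))), zero_add] at h1
    rw [reject_inj_Ici he, ← h1, mult_inj he hA, Finset.card_filter, Finset.sum_filter]
    refine Finset.sum_le_sum fun l _ => ?_
    split_ifs <;> simp_all

theorem mult_reject_erase (he : IsBasicSystem e) (hA : IsOneQuasiHereditary K e) {i j : ι}
    {U : Finset ι} (hU : IsUpper j U) (hi : Minimal (· ∈ U) i) (k : ι) :
    mult K e (reject e (U.erase i : Finset ι) (Inj K e j)) k =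
      mult K e (reject e U (Inj K e j)) k + if k ≤ i then 1 else 0 := by
  have := finiteDimensional_inj K e j
  have h1 := mult_eq_add_quotient (K := K) (he.complete.idem k) (reject e U (Inj K e j))
  have h2 := mult_eq_add_quotient (K := K) (he.complete.idem k)
    (reject e (U.erase i : Finset ι) (Inj K e j))
  rw [mult_quotient_reject he hA hU, ← Finset.add_sum_erase _ _ hi.1] at h1
  rw [mult_quotient_reject he hA (hU.erase hi)] at h2
  omega

theorem nonempty_reject_subquot_equiv (he : IsBasicSystem e) (hA : IsOneQuasiHereditary K e)
    {i j : ι} {U : Finset ι} (hU : IsUpper j U) (hi : Minimal (· ∈ U) i) :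
    Nonempty (Subquot (reject e (U.erase i : Finset ι) (Inj K e j)) (reject e U (Inj K e j)) ≃ₗ[A]
      Costd K e i) := by
  have := finiteDimensional_inj K e j
  have := finiteDimensional_inj K e i
  have := finiteDimensional_submodule (K := K) (Costd K e i)
  obtain ⟨f, hf⟩ := exists_subquot_to_costd he hA hU hi.1
  refine ⟨LinearEquiv.ofBijective f ⟨hf, surjective_of_mult_le (K := K) he.complete hf fun k => ?_⟩⟩
  have h := mult_eq_add_subquot (K := K) (he.complete.idem k) (reject_le_erase (e := e)
    (M := Inj K e j) U i)
  rw [mult_reject_erase he hA hU hi] at h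
  have := mult_costd_le he hA i k
  omega

/-- The upper bound is attained: ∇(i) is the subquotient of I(i) obtained by removing i from {l | i
≤ l}. -/
theorem mult_costd (he : IsBasicSystem e) (hA : IsOneQuasiHereditary K e) (i k : ι) :
    mult K e (Costd K e i) k = if k ≤ i then 1 else 0 := by
  have := finiteDimensional_inj K e i
  have hi : Minimal (· ∈ Finset.univ.filter (i ≤ ·)) i :=
    ⟨by simp, fun y hy _ => (Finset.mem_filter.1 hy).2⟩
  have h := mult_eq_add_subquot (K := K) (he.complete.idem k) (reject_le_erase (e := e)
    (M := Inj K e i) (Finset.univ.filter (i ≤ ·)) i)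
  rw [mult_reject_erase he hA (isUpper_Ici i) hi, mult_eq_of_equiv
    (nonempty_reject_subquot_equiv he hA (isUpper_Ici i) hi).some] at h
  omega

theorem lt_reject_iff (he : IsBasicSystem e) (hA : IsOneQuasiHereditary K e)
    {i j : ι} {U : Finset ι} (hU : IsUpper j U) (N : Submodule A (Inj K e j)) :
    (reject e U (Inj K e j) < N ∧
      Nonempty (Subquot N (reject e U (Inj K e j)) ≃ₗ[A] Costd K e i)) ↔
      Minimal (· ∈ U) i ∧ N = reject e (U.erase i : Finset ι) (Inj K e j) := by
  have := finiteDimensional_inj K e j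
  have := finiteDimensional_inj K e i
  constructor
  · rintro ⟨hlt, ⟨g⟩⟩
    have := finiteDimensional_submodule (K := K) N
    have hmin : Minimal (· ∈ U) i := by
      have hfd := finiteDimensional_quotient (K := K) ((reject e U (Inj K e j)).submoduleOf N)
      obtain ⟨_, _⟩ := isArtinian_of_finiteDimensional K (A := A)
        (M := Subquot N (reject e U (Inj K e j)))
      -- A simple submodule S of the subquotient is supported at i, as ∇(i) sits in I(i). It is also
      -- supported at a minimal vertex of U, since the rejects at minimal vertices already cut out
      -- the reject of U. The two vertices coincide.
      obtain ⟨S, hS, -⟩ := (eq_bot_or_exists_atom_le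
        (⊤ : Submodule A (Subquot N (reject e U (Inj K e j))))).resolve_left (fun h => by
          have := mult_top (K := K) (e := e) (M := Subquot N (reject e U (Inj K e j))) i
          rw [h, mult_eq_zero_of_subsingleton, mult_eq_of_equiv g, mult_costd he hA] at this
          simp at this)
      have hSs : IsSimpleModule A S := isSimpleModule_iff_isAtom.2 hS
      obtain ⟨x, hxS, hx0⟩ := Submodule.exists_mem_ne_zero_of_ne_bot hS.1
      have h1 : ∃ a : A, e i • a • x ≠ 0 := by
        by_contra! h
        refine hx0 (g.map_eq_zero_iff.1 (Subtype.ext ?_))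
        rw [Submodule.coe_zero, ← Submodule.mem_bot A,
          ← reject_inj_self (K := K) (he.complete.idem i)]
        rintro _ rfl a
        have := congrArg g (h a)
        rw [map_smul, map_smul, map_zero] at this
        exact congrArg Subtype.val this
      have h2 : ∃ l, Minimal (· ∈ U) l ∧ ∃ a : A, e l • a • x ≠ 0 := by
        obtain ⟨y, rfl⟩ := Submodule.mkQ_surjective _ x
        by_contra! h
        refine hx0 ?_
        rw [Submodule.mkQ_apply, Submodule.Quotient.mk_eq_zero]
        change (y : Inj K e j) ∈ reject e U (Inj K e j)
        intro k hk
        obtain ⟨l, hlk, hl⟩ := exists_minimal_le (Finset.mem_coe.1 hk)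
        refine reject_inj_anti he hA (hU.2 l hl.1) hlk ?_ k rfl
        rintro _ rfl a
        have h3 := h _ hl a
        rw [← map_smul, ← map_smul, Submodule.mkQ_apply, Submodule.Quotient.mk_eq_zero] at h3
        change e _ • a • (y : Inj K e j) ∈ reject e U (Inj K e j) at h3
        have h4 := smul_eq_zero_of_mem_reject h3 (Finset.mem_coe.2 hl.1)
        rwa [← mul_smul, (he.complete.idem _).eq] at h4
      obtain ⟨a, ha⟩ := h1
      obtain ⟨l, hl, b, hb⟩ := h2
      have : i = l := eq_of_smul_ne_zero K he (M := S) (x := ⟨a • x, S.smul_mem a hxS⟩)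
        (y := ⟨b • x, S.smul_mem b hxS⟩) (fun h => ha (congrArg Subtype.val h))
        (fun h => hb (congrArg Subtype.val h))
      exact this ▸ hl
    refine ⟨hmin, eq_of_le_of_mult_le (K := K) he.complete ?_ fun k => ?_⟩
    · intro x hx l hl a
      have hl' : l ≠ i ∧ l ∈ U := Finset.mem_erase.1 (Finset.mem_coe.1 hl)
      have hli : ¬ l ≤ i := fun h => hl'.1 (le_antisymm h (hmin.2 hl'.2 h))
      have h0 : mult K e (Subquot N (reject e U (Inj K e j))) l = 0 := by
        rw [mult_eq_of_equiv g, mult_costd he hA, if_neg hli]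
      have := (mult_quotient_eq_zero_iff (K := K) _ l).1 h0 ⟨a • x, N.smul_mem a hx⟩
      change e l • a • x ∈ reject e U (Inj K e j) at this
      have := smul_eq_zero_of_mem_reject this (Finset.mem_coe.2 hl'.2)
      rwa [← mul_smul, (he.complete.idem l).eq] at this
    · have h1 := mult_eq_add_subquot (K := K) (he.complete.idem k) hlt.le
      rw [mult_eq_of_equiv g, mult_costd he hA] at h1
      rw [mult_reject_erase he hA hU hmin]
      omega
  · rintro ⟨hmin, rfl⟩
    have g := nonempty_reject_subquot_equiv he hA hU hmin
    refine ⟨lt_of_le_of_ne (reject_le_erase U i) fun h => ?_, g⟩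
    have h1 := mult_reject_erase he hA hU hmin i
    rw [← h] at h1
    simp at h1

end CostandardStep

/-! ### Good sequences as successive removals of minimal elements -/

section Sequences

open scoped Classical

variable {ι : Type*} [Fintype ι] [PartialOrder ι]

/-- The set of the entries of `s` from position `t` on. -/
noncomputable def tail {n : ℕ} (s : Fin n → ι) (t : Fin (n + 1)) : Finset ι :=
  (Finset.univ.filter fun m : Fin n => t ≤ m.castSucc).image s

theorem mem_tail {n : ℕ} {s : Fin n → ι} {t : Fin (n + 1)} {x : ι} :
    x ∈ tail s t ↔ ∃ m : Fin n, t ≤ m.castSucc ∧ s m = x := by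
  simp [tail]

theorem coe_tail {n : ℕ} (s : Fin n → ι) (t : Fin (n + 1)) :
    (tail s t : Set ι) = ⋃ m : Fin n, ⋃ _ : t ≤ m.castSucc, {s m} := by
  ext x
  simp [mem_tail, eq_comm]

theorem tail_last {n : ℕ} (s : Fin n → ι) : tail s (Fin.last n) = ∅ := by
  refine Finset.eq_empty_of_forall_notMem fun x hx => ?_
  obtain ⟨m, hm, -⟩ := mem_tail.1 hx
  exact (Fin.castSucc_lt_last m).not_ge hm

theorem card_filter_eq_card_Ici (j : ι) :
    (Finset.univ.filter (j ≤ ·)).card = Nat.card (Set.Ici j) := by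
  rw [Nat.card_eq_fintype_card, ← Fintype.card_subtype]
  exact Fintype.card_congr (Equiv.refl _)

theorem goodSeq_injective {j : ι} {s : Fin (Nat.card (Set.Ici j)) → ι} (hs : s ∈ goodSeq j) :
    Function.Injective s := by
  intro k t hkt
  rcases lt_trichotomy k t with h | h | h
  · exact (hs.2 k t h hkt.ge).elim
  · exact h
  · exact (hs.2 t k h hkt.le).elim

/-- A good sequence is injective and as long as {l | j ≤ l} is large, so it enumerates this set. -/
theorem tail_zero {j : ι} {s : Fin (Nat.card (Set.Ici j)) → ι} (hs : s ∈ goodSeq j) :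
    tail s 0 = Finset.univ.filter (j ≤ ·) := by
  refine Finset.eq_of_subset_of_card_le (fun x hx => ?_) ?_
  · obtain ⟨m, -, rfl⟩ := mem_tail.1 hx
    simpa using hs.1 m
  · rw [card_filter_eq_card_Ici, tail, Finset.card_image_of_injective _ (goodSeq_injective hs),
      Finset.filter_true_of_mem fun m _ => Fin.zero_le _, Finset.card_univ, Fintype.card_fin]

theorem isUpper_tail {j : ι} {s : Fin (Nat.card (Set.Ici j)) → ι} (hs : s ∈ goodSeq j)
    (t : Fin (Nat.card (Set.Ici j) + 1)) : IsUpper j (tail s t) := by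
  refine ⟨fun a b hab ha => ?_, fun l hl => ?_⟩
  · obtain ⟨m, hm, rfl⟩ := mem_tail.1 ha
    have hb : b ∈ tail s 0 := by
      rw [tail_zero hs]
      simpa using (hs.1 m).trans hab
    obtain ⟨m', -, rfl⟩ := mem_tail.1 hb
    refine mem_tail.2 ⟨m', ?_, rfl⟩
    by_contra h
    exact hs.2 m' m (Fin.castSucc_lt_castSucc_iff.1 ((not_le.1 h).trans_le hm)) hab
  · obtain ⟨m, -, rfl⟩ := mem_tail.1 hl
    exact hs.1 m

theorem minimal_tail {j : ι} {s : Fin (Nat.card (Set.Ici j)) → ι} (hs : s ∈ goodSeq j)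
    (t : Fin (Nat.card (Set.Ici j))) : Minimal (· ∈ tail s t.castSucc) (s t) := by
  refine ⟨mem_tail.2 ⟨t, le_rfl, rfl⟩, fun y hy hyt => ?_⟩
  obtain ⟨m, hm, rfl⟩ := mem_tail.1 hy
  rcases (Fin.castSucc_le_castSucc_iff.1 hm).eq_or_lt with rfl | h
  · exact le_rfl
  · exact (hs.2 t m h hyt).elim

theorem tail_erase {j : ι} {s : Fin (Nat.card (Set.Ici j)) → ι} (hs : s ∈ goodSeq j)
    (t : Fin (Nat.card (Set.Ici j))) : (tail s t.castSucc).erase (s t) = tail s t.succ := by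
  ext x
  simp only [Finset.mem_erase, mem_tail, Fin.castSucc_le_castSucc_iff, Fin.succ_le_castSucc_iff]
  constructor
  · rintro ⟨hx, m, hm, rfl⟩
    exact ⟨m, lt_of_le_of_ne hm fun h => hx (congrArg s h.symm), rfl⟩
  · rintro ⟨m, hm, rfl⟩
    exact ⟨fun h => hm.ne (goodSeq_injective hs h).symm, m, hm.le, rfl⟩

/-- Chains that start in `D {i | j ≤ i}`, end in `D ∅`, and whose steps are the removals of minimal
elements, are given by good sequences. -/
theorem eq_tail_of_chain {L : Type*} {D : Finset ι → L} {Q : L → L → ι → Prop} {j : ι}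
    (hQ : ∀ U, IsUpper j U → ∀ i N, Q (D U) N i ↔ Minimal (· ∈ U) i ∧ N = D (U.erase i))
    (hD : ∀ U, IsUpper j U → D U = D ∅ → U = ∅) {n : ℕ} {G : Fin (n + 1) → L} {lab : Fin n → ι}
    (h0 : G 0 = D (Finset.univ.filter (j ≤ ·))) (hlast : G (Fin.last n) = D ∅)
    (hG : ∀ t : Fin n, Q (G t.castSucc) (G t.succ) (lab t)) :
    n = Nat.card (Set.Ici j) ∧ (∀ m, j ≤ lab m) ∧ (∀ k t, k < t → ¬ lab t ≤ lab k) ∧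
      ∀ t, G t = D (tail lab t) := by
  -- The vertices not yet removed at time t. This form needs no knowledge that the labels exhaust {l
  -- | j ≤ l}, which is only obtained at the end.
  set U : Fin (n + 1) → Finset ι := fun t =>
    Finset.univ.filter (j ≤ ·) \ (Finset.univ.filter fun m : Fin n => m.castSucc < t).image lab
    with hU
  have mem_U : ∀ {t x}, x ∈ U t ↔ j ≤ x ∧ ∀ m : Fin n, m.castSucc < t → lab m ≠ x := by
    intro t x
    simp [hU]
  have U_succ : ∀ t : Fin n, U t.succ = (U t.castSucc).erase (lab t) := by
    intro t
    ext x
    simp only [Finset.mem_erase, mem_U, Fin.castSucc_lt_castSucc_iff, Fin.castSucc_lt_succ_iff]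
    constructor
    · exact fun h => ⟨(h.2 t le_rfl).symm, h.1, fun m hm => h.2 m hm.le⟩
    · rintro ⟨h1, h2, h3⟩
      refine ⟨h2, fun m hm => ?_⟩
      rcases hm.eq_or_lt with rfl | hm
      · exact h1.symm
      · exact h3 m hm
  have key : ∀ t, IsUpper j (U t) ∧ G t = D (U t) := by
    intro t
    induction t using Fin.induction with
    | zero =>
      have : U 0 = Finset.univ.filter (j ≤ ·) := by
        ext x
        simp [mem_U]
      rw [this]
      exact ⟨isUpper_Ici j, h0⟩
    | succ t ih =>
      have h := hG t
      rw [ih.2, hQ _ ih.1] at h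
      rw [U_succ]
      exact ⟨ih.1.erase h.1, h.2⟩
  have hmin : ∀ t : Fin n, Minimal (· ∈ U t.castSucc) (lab t) := fun t => by
    have h := hG t
    rw [(key _).2, hQ _ (key _).1] at h
    exact h.1
  have hne : ∀ k t, k < t → lab k ≠ lab t := fun k t hkt =>
    (mem_U.1 (hmin t).1).2 k (Fin.castSucc_lt_castSucc_iff.2 hkt)
  have hinj : Function.Injective lab := by
    intro k t hkt
    rcases lt_trichotomy k t with h | h | h
    · exact (hne k t h hkt).elim
    · exact h
    · exact (hne t k h hkt.symm).elim
  have hj : ∀ m, j ≤ lab m := fun m => (mem_U.1 (hmin m).1).1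
  -- Only here is the end of the chain used: all vertices have been removed, which fixes the length
  -- n.
  have hUlast : U (Fin.last n) = ∅ := hD _ (key _).1 ((key _).2.symm.trans hlast)
  have hsurj : ∀ x, j ≤ x → ∃ m, lab m = x := by
    intro x hx
    by_contra! h
    have : x ∈ U (Fin.last n) := mem_U.2 ⟨hx, fun m _ => h m⟩
    rw [hUlast] at this
    exact Finset.notMem_empty x this
  refine ⟨?_, hj, fun k t hkt hle => ?_, fun t => ?_⟩
  · rw [← card_filter_eq_card_Ici]
    have : Finset.univ.filter (j ≤ ·) = Finset.univ.image lab := by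
      ext x
      simp only [Finset.mem_filter, Finset.mem_univ, true_and, Finset.mem_image]
      exact ⟨hsurj x, by rintro ⟨m, rfl⟩; exact hj m⟩
    rw [this, Finset.card_image_of_injective _ hinj]
    simp
  · have ht : lab t ∈ U k.castSucc := mem_U.2 ⟨hj t, fun m hm =>
      hne m t ((Fin.castSucc_lt_castSucc_iff.1 hm).trans hkt)⟩
    exact hne k t hkt (le_antisymm ((hmin k).2 ht hle) hle)
  · rw [(key t).2]
    congr 1
    ext x
    rw [mem_U, mem_tail]
    constructor
    · rintro ⟨h1, h2⟩
      obtain ⟨m, rfl⟩ := hsurj x h1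
      exact ⟨m, not_lt.1 fun h => h2 m h rfl, rfl⟩
    · rintro ⟨m, hm, rfl⟩
      exact ⟨hj m, fun k hk => hne k m (Fin.castSucc_lt_castSucc_iff.1 (hk.trans_le hm))⟩

end Sequences

/-! ### The bijections with good filtrations -/

section Filtrations

open scoped Classical

variable {K A ι : Type*} [Field K] [Ring A] [Algebra K A] [FiniteDimensional K A]
  [Fintype ι] [PartialOrder ι] [BoundedOrder ι] {e : ι → A}

theorem trace_step (he : IsBasicSystem e) (hA : IsOneQuasiHereditary K e) {j : ι}
    (s : goodSeq j) (t : Fin (Nat.card (Set.Ici j))) :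
    trace e (tail s.1 t.succ) (Proj e j) < trace e (tail s.1 t.castSucc) (Proj e j) ∧
      Nonempty (Subquot (trace e (tail s.1 t.castSucc) (Proj e j))
        (trace e (tail s.1 t.succ) (Proj e j)) ≃ₗ[A] Std K e (s.1 t)) := by
  refine (trace_lt_iff he hA (isUpper_tail s.2 t.castSucc) _).2 ⟨minimal_tail s.2 t, ?_⟩
  rw [tail_erase s.2]

theorem reject_step (he : IsBasicSystem e) (hA : IsOneQuasiHereditary K e) {j : ι}
    (s : goodSeq j) (t : Fin (Nat.card (Set.Ici j))) :
    reject e (tail s.1 t.castSucc) (Inj K e j) < reject e (tail s.1 t.succ) (Inj K e j) ∧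
      Nonempty (Subquot (reject e (tail s.1 t.succ) (Inj K e j))
        (reject e (tail s.1 t.castSucc) (Inj K e j)) ≃ₗ[A] Costd K e (s.1 t)) := by
  refine (lt_reject_iff he hA (isUpper_tail s.2 t.castSucc) _).2 ⟨minimal_tail s.2 t, ?_⟩
  rw [tail_erase s.2]

/-- The `Δ`-good filtration of `P(j)` attached to a good sequence. -/
noncomputable def stdFiltration (he : IsBasicSystem e) (hA : IsOneQuasiHereditary K e) {j : ι}
    (s : goodSeq j) : StdFiltration K e (Proj e j) :=
  ⟨{ length := Nat.card (Set.Ici j)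
     -- An `LTSeries` ascends whereas the D(t) descend, hence the reversed index; for rejects no
     -- reversal is needed.
     toFun := fun t => trace e (tail s.1 t.rev) (Proj e j)
     step := fun t => by
      change trace e (tail s.1 t.castSucc.rev) _ < trace e (tail s.1 t.succ.rev) _
      rw [Fin.rev_castSucc, Fin.rev_succ]
      exact (trace_step he hA s t.rev).1 },
    { head := by
        change trace e (tail s.1 (Fin.rev 0)) (Proj e j) = ⊥
        rw [Fin.rev_zero, tail_last, Finset.coe_empty, trace_empty]
      last := by
        change trace e (tail s.1 (Fin.last _).rev) (Proj e j) = ⊤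
        rw [Fin.rev_last, tail_zero s.2]
        exact trace_proj_self (he.complete.idem j) (by simp)
      subquot := fun t => by
        refine ⟨s.1 t.rev, ?_⟩
        change Nonempty (Subquot (trace e (tail s.1 t.succ.rev) (Proj e j))
          (trace e (tail s.1 t.castSucc.rev) (Proj e j)) ≃ₗ[A] _)
        rw [Fin.rev_castSucc, Fin.rev_succ]
        exact (trace_step he hA s t.rev).2 }⟩

/-- The `∇`-good filtration of `I(j)` attached to a good sequence. -/
noncomputable def costdFiltration (he : IsBasicSystem e) (hA : IsOneQuasiHereditary K e) {j : ι}
    (s : goodSeq j) : CostdFiltration K e (Inj K e j) :=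
  ⟨{ length := Nat.card (Set.Ici j)
     toFun := fun t => reject e (tail s.1 t) (Inj K e j)
     step := fun t => (reject_step he hA s t).1 },
    { head := by
        change reject e (tail s.1 0) (Inj K e j) = ⊥
        rw [tail_zero s.2, reject_inj_Ici he]
      last := by
        change reject e (tail s.1 (Fin.last _)) (Inj K e j) = ⊤
        rw [tail_last, Finset.coe_empty, reject_empty]
      subquot := fun t => ⟨s.1 t, (reject_step he hA s t).2⟩ }⟩

theorem stdFiltration_bijective (he : IsBasicSystem e) (hA : IsOneQuasiHereditary K e) (j : ι) :
    Function.Bijective (stdFiltration he hA (j := j)) := by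
  constructor
  · intro s s' h
    have h1 := congrArg Subtype.val h
    injection h1 with _ h2
    have h3 : ∀ t, trace e (tail s.1 t) (Proj e j) = trace e (tail s'.1 t) (Proj e j) := fun t => by
      have := congrFun h2 t.rev
      simpa only [Fin.rev_rev] using this
    -- The filtration determines the isomorphism type Δ(s t) of each subquotient, hence s t.
    refine Subtype.ext (funext fun t => ?_)
    have g := (trace_step he hA s t).2
    rw [h3, h3] at g
    exact eq_of_mult_eq_ite (X := fun i => Std K e i) (mult_std hA)
      (g.some.symm.trans (trace_step he hA s' t).2.some)
  · rintro ⟨⟨n, F, hF⟩, hgood⟩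
    obtain ⟨h0, h1, hsub⟩ := hgood
    change F 0 = ⊥ at h0
    change F (Fin.last n) = ⊤ at h1
    change ∀ t : Fin n, F t.castSucc < F t.succ at hF
    change ∀ t : Fin n, ∃ i, Nonempty (Subquot (F t.succ) (F t.castSucc) ≃ₗ[A] Std K e i) at hsub
    have hsub' := hsub
    choose lab hlab using hsub'
    obtain ⟨rfl, hj, hlt, hG⟩ := eq_tail_of_chain (j := j) (n := n)
      (D := fun U : Finset ι => trace e U (Proj e j))
      (Q := fun N N' i => N' < N ∧ Nonempty (Subquot N N' ≃ₗ[A] Std K e i))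
      (G := fun t => F t.rev) (lab := fun t => lab t.rev)
      (fun U hU i N => trace_lt_iff he hA hU N)
      (fun U hU h => by
        -- Any i in U contributes 1 to the multiplicity of the trace at i, so a zero trace forces U
        -- to be empty.
        refine Finset.eq_empty_of_forall_notMem fun i hi => ?_
        have := mult_trace he hA hU i
        rw [h, Finset.coe_empty, trace_empty, mult_eq_zero_of_subsingleton] at this
        have := (Finset.sum_eq_zero_iff.1 this.symm) i hi
        simp at this)
      (by
        rw [Fin.rev_zero, h1, trace_proj_self (he.complete.idem j) (by simp)])
      (by
        rw [Fin.rev_last, h0, Finset.coe_empty, trace_empty])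
      (fun t => by
        rw [Fin.rev_castSucc, Fin.rev_succ]
        exact ⟨hF t.rev, hlab t.rev⟩)
    refine ⟨⟨fun t => lab t.rev, hj, hlt⟩, Subtype.ext ?_⟩
    have : F = fun t => trace e (tail (fun t => lab t.rev) t.rev) (Proj e j) := by
      funext t
      have := hG t.rev
      rwa [Fin.rev_rev] at this
    subst this
    rfl

theorem costdFiltration_bijective (he : IsBasicSystem e) (hA : IsOneQuasiHereditary K e) (j : ι) :
    Function.Bijective (costdFiltration he hA (j := j)) := by
  constructor
  · intro s s' h
    have h1 := congrArg Subtype.val h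
    injection h1 with _ h2
    have h3 : ∀ t, reject e (tail s.1 t) (Inj K e j) = reject e (tail s'.1 t) (Inj K e j) :=
      congrFun h2
    refine Subtype.ext (funext fun t => ?_)
    have g := (reject_step he hA s t).2
    rw [h3, h3] at g
    exact eq_of_mult_eq_ite (X := fun i => Costd K e i) (mult_costd he hA)
      (g.some.symm.trans (reject_step he hA s' t).2.some)
  · rintro ⟨⟨n, F, hF⟩, hgood⟩
    obtain ⟨h0, h1, hsub⟩ := hgood
    change F 0 = ⊥ at h0
    change F (Fin.last n) = ⊤ at h1
    change ∀ t : Fin n, F t.castSucc < F t.succ at hF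
    change ∀ t : Fin n, ∃ i, Nonempty (Subquot (F t.succ) (F t.castSucc) ≃ₗ[A] Costd K e i) at hsub
    have hsub' := hsub
    choose lab hlab using hsub'
    obtain ⟨rfl, hj, hlt, hG⟩ := eq_tail_of_chain (j := j) (n := n)
      (D := fun U : Finset ι => reject e U (Inj K e j))
      (Q := fun N N' i => N < N' ∧ Nonempty (Subquot N' N ≃ₗ[A] Costd K e i))
      (G := F) (lab := lab)
      (fun U hU i N => lt_reject_iff he hA hU N)
      (fun U hU h => by
        refine Finset.eq_empty_of_forall_notMem fun i hi => ?_
        have := mult_quotient_reject he hA hU i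
        rw [h, Finset.coe_empty, reject_empty, mult_eq_zero_of_subsingleton] at this
        have := (Finset.sum_eq_zero_iff.1 this.symm) i hi
        simp at this)
      (h0.trans (reject_inj_Ici he j).symm)
      (by rw [h1, Finset.coe_empty, reject_empty])
      (fun t => ⟨hF t, hlab t⟩)
    refine ⟨⟨lab, hj, hlt⟩, Subtype.ext ?_⟩
    obtain rfl : F = fun t => reject e (tail lab t) (Inj K e j) := funext hG
    rfl

end Filtrations

end OneQH

/-! ### The theorem on good filtrations of P(j) and I(j) -/

theorem mainTheorem3 {K A ι : Type*} [Field K] [IsAlgClosed K] [Ring A] [Algebra K A]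
    [FiniteDimensional K A] [Fintype ι] [PartialOrder ι] [BoundedOrder ι]
    (e : ι → A) (he : OneQH.IsBasicSystem e) (hA : OneQH.IsOneQuasiHereditary K e) (j : ι) :
    -- the projective case; `p i` is the unique submodule of `P(j)` isomorphic to `P(i)`
    (∃ (p : ι → Submodule A (OneQH.Proj e j))
        (𝒟 : OneQH.goodSeq j → OneQH.StdFiltration K e (OneQH.Proj e j)),
      (∀ i, j ≤ i → ∀ N : Submodule A (OneQH.Proj e j),
        Nonempty (N ≃ₗ[A] OneQH.Proj e i) ↔ N = p i) ∧
      Function.Bijective 𝒟 ∧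
      ∀ s : OneQH.goodSeq j, ∃ D : Fin (Nat.card (Set.Ici j) + 1) → Submodule A (OneQH.Proj e j),
        (∀ t, D t = ⨆ m : Fin (Nat.card (Set.Ici j)), ⨆ _ : t ≤ m.castSucc, p (s.1 m)) ∧
        (∃ h : (𝒟 s).1.length = Nat.card (Set.Ici j),
          ∀ t, (𝒟 s).1 (Fin.cast (congrArg (· + 1) h.symm) t) = D t.rev) ∧
        ∀ t : Fin (Nat.card (Set.Ici j)),
          Nonempty (OneQH.Subquot (D t.castSucc) (D t.succ) ≃ₗ[A] OneQH.Std K e (s.1 t))) ∧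
    -- the injective case; `κ i` is the unique submodule of `P(⊥)` with factor module `I(i)`
    (∃ (κ : ι → Submodule A (OneQH.Proj e (⊥ : ι)))
        (𝒩 : OneQH.goodSeq j → OneQH.CostdFiltration K e (OneQH.Inj K e j)),
      (∀ i, ∀ N : Submodule A (OneQH.Proj e (⊥ : ι)),
        Nonempty ((OneQH.Proj e (⊥ : ι) ⧸ N) ≃ₗ[A] OneQH.Inj K e i) ↔ N = κ i) ∧
      (∀ i, j ≤ i → κ j ≤ κ i) ∧
      Function.Bijective 𝒩 ∧
      ∀ π : OneQH.Proj e (⊥ : ι) →ₗ[A] OneQH.Inj K e j, Function.Surjective π →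
        ∀ s : OneQH.goodSeq j, ∃ N : Fin (Nat.card (Set.Ici j) + 1) → Submodule A (OneQH.Inj K e j),
          (∀ t, N t = Submodule.map π
            (⨅ m : Fin (Nat.card (Set.Ici j)), ⨅ _ : t ≤ m.castSucc, κ (s.1 m))) ∧
          (∃ h : (𝒩 s).1.length = Nat.card (Set.Ici j),
            ∀ t, (𝒩 s).1 (Fin.cast (congrArg (· + 1) h.symm) t) = N t) ∧
          ∀ t : Fin (Nat.card (Set.Ici j)),
            Nonempty (OneQH.Subquot (N t.succ) (N t.castSucc) ≃ₗ[A] OneQH.Costd K e (s.1 t))) := by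
  refine ⟨⟨fun i => OneQH.trace e {i} (OneQH.Proj e j), OneQH.stdFiltration he hA,
    fun i hi N => OneQH.nonempty_equiv_proj_iff he hA hi N,
    OneQH.stdFiltration_bijective he hA j, fun s =>
      ⟨fun t => OneQH.trace e (OneQH.tail s.1 t) (OneQH.Proj e j), fun t => ?_, ⟨rfl, fun t => rfl⟩,
        fun t => (OneQH.trace_step he hA s t).2⟩⟩,
    ⟨fun i => OneQH.reject e {i} (OneQH.Proj e (⊥ : ι)), OneQH.costdFiltration he hA,
      fun i N => OneQH.nonempty_quotient_equiv_inj_iff he hA i N,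
      fun i hi => OneQH.reject_proj_bot_anti he hA hi,
      OneQH.costdFiltration_bijective he hA j, fun π hπ s =>
        ⟨fun t => OneQH.reject e (OneQH.tail s.1 t) (OneQH.Inj K e j), fun t => ?_,
          ⟨rfl, fun t => rfl⟩, fun t => (OneQH.reject_step he hA s t).2⟩⟩⟩
  · simp only [OneQH.coe_tail, OneQH.trace_iUnion]
  · simp only [← OneQH.reject_iUnion]
    rw [← OneQH.coe_tail]
    -- The kernel of π lies in every κ(l) with l ≥ j, so the image of the intersection is a reject
    -- of I(j), independent of π.
    exact (OneQH.map_reject_proj_bot he hA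
      (fun l hl => (OneQH.isUpper_tail s.2 t).2 l (Finset.mem_coe.1 hl)) hπ).symm
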